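/- For $x\in\mathbb F_2^n$ let $|x|$ be its Hamming weight, and for $0\le j<p$ let $\mathsf{Mod}_{p,j}:\mathbb F_2^n\to\mathbb F_2$ be the function with $\mathsf{Mod}_{p,j}(x)=0$ if $|x|\equiv j \pmod p$ and $\mathsf{Mod}_{p,j}(x)=1$ otherwise. An $l2$-MBQC with input $x\in\mathbb F_2^n$ on an $L_Q$-qubit resource state $|\psi\rangle$ consists of Hermitian single-qubit observables $O_k(s)$ ($k\in\{1,\dots,L_Q\}$, $s\in\mathbb F_2$) with $O_k(s)^2=I$ and eigenvalues $\pm1$, matrices $P\in\mathbb F_2^{L_Q\times n}$ and $A\in\mathbb F_2^{L_Q\times L_Q}$, where $A$ is strictly lower triangular for a suitable ordering of the qubits, a vector $o\in\mathbb F_2^{L_Q}$ and a constant $c\in\mathbb F_2$. Qubit $k$ is measured in the eigenbasis of $O_k(s_k)$, with outcome $m_k\in\mathbb F_2$ (eigenvalue $(-1)^{m_k}$), where $s=Px\oplus Am$; the output is $y=o^Tm\oplus c$. It computes $f$ deterministically if for every $x$ the output equals $f(x)$ with probability $1$. Its resource costs are: $L_Q$, the number of qubits; $L_C$, the number of classical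 bits of the side-processor, that is, the number of distinct not identically zero parities of $x$ output by $P$ plus the number of running parity bits of measurement outcomes (read along the qubits in their given order) from which all the contributions $(Am)_k$ and the output are obtained mod-2 linearly; $T_C$, the number of rounds of measurement, where each setting depends only on $x$ and on outcomes of strictly earlier rounds; and $T_Q$, the depth of a circuit preparing $|\psi\rangle$ from $|0\rangle^{\otimes L_Q}$. The 1D cluster state on $N$ qubits is $\bigl(\prod_{k=1}^{N-1}\mathrm CZ_{k,k+1}\bigr)H^{\otimes N}|0\rangle^{\otimes N}$. Theorem. For every odd $p\ge1$, every $j\in\{0,\dots,p-1\}$ and every $n$, the function $\mathsf{Mod}_{p,j}:\mathbb F_2^n\to\mathbb F_2$ is computed deterministically by an (adaptive) $l2$-MBQC whose resource state is the 1D cluster state on $$L_Q=(4p-2)(n+1)-1$$ qubits, with $L_C=n+2$ classical bits, $T_C=4p-2$ rounds, and $T_Q=3$, the cluster state being prepared by a depth-3 circuit of Hadamard and nearest-neighbour $\mathrm CZ$ gates. -/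

import Mathlib

namespace L2MBQC

/-- Binary strings of length `n`, that is, the vector space `𝔽₂ⁿ`. -/
abbrev Bits (n : ℕ) : Type := Fin n → ZMod 2

/-- (Not necessarily normalized) states of `N` qubits, by their amplitudes in the
computational basis. -/
abbrev Ket (N : ℕ) : Type := Bits N → ℂ

/-- Single-qubit operators, in the computational basis. -/
abbrev Op : Type := Matrix (ZMod 2) (ZMod 2) ℂ

/-- The sign `(-1)^m`. -/
def sgn (m : ZMod 2) : ℂ := if m = 0 then 1 else -1

/-- `Mod_{p,j}` on `n` bits: `0` if the Hamming weight is `j` modulo `p`, and `1` otherwise. -/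
def modFn (p j n : ℕ) (x : Bits n) : ZMod 2 :=
  if hammingNorm x ≡ j [MOD p] then 0 else 1

noncomputable section

/-! ### Circuits and the one-dimensional cluster state -/

/-- The Hadamard operator `(∑_{a,b} (-1)^{ab} |a⟩⟨b|) / √2`. -/
def hadamard : Op := Matrix.of fun a b => sgn (a * b) / (Real.sqrt 2 : ℂ)

/-- The single-qubit operator `U` applied to qubit `k` of `ψ`. -/
def applyOne {N : ℕ} (U : Op) (k : Fin N) (ψ : Ket N) : Ket N :=
  fun a => ∑ b : ZMod 2, U (a k) b * ψ (Function.update a k b)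

/-- The controlled-`Z` operator applied to qubits `i`, `j` of `ψ`. -/
def applyCZ {N : ℕ} (i j : Fin N) (ψ : Ket N) : Ket N :=
  fun a => sgn (a i * a j) * ψ a

/-- The state `|0⟩^{⊗N}`. -/
def ketZero (N : ℕ) : Ket N := fun a => if a = 0 then 1 else 0

/-- The state `H^{⊗N} |0⟩^{⊗N}`. -/
def ketPlus (N : ℕ) : Ket N :=
  (List.finRange N).foldl (fun ψ k => applyOne hadamard k ψ) (ketZero N)

/-- The cluster state on a chain of `N` qubits,
`(∏_{k} CZ_{k,k+1}) H^{⊗N} |0⟩^{⊗N}`. -/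
def clusterState (N : ℕ) : Ket N :=
  (List.finRange N).foldl
    (fun ψ k => if h : k.val + 1 < N then applyCZ k ⟨k.val + 1, h⟩ ψ else ψ) (ketPlus N)

/-- The gates of a circuit on a chain of `N` qubits: Hadamard gates and nearest-neighbour
controlled-`Z` gates. -/
inductive Gate (N : ℕ) : Type
  | had (k : Fin N) : Gate N
  | cz (i j : Fin N) (h : i.val + 1 = j.val) : Gate N

/-- The qubits on which a gate acts. -/
def Gate.support {N : ℕ} : Gate N → Finset (Fin N)
  | .had k => {k}
  | .cz i j _ => {i, j}

/-- The action of a gate on states. -/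
def Gate.apply {N : ℕ} : Gate N → Ket N → Ket N
  | .had k, ψ => applyOne hadamard k ψ
  | .cz i j _, ψ => applyCZ i j ψ

/-- `ψ` is prepared from `|0⟩^{⊗N}` by a circuit of depth `T`: a sequence of `T` layers, where
the gates in one layer act on pairwise disjoint sets of qubits. -/
def PreparedInDepth {N : ℕ} (ψ : Ket N) (T : ℕ) : Prop :=
  ∃ layers : List (List (Gate N)),
    layers.length = T ∧
    (∀ l ∈ layers, l.Pairwise fun g h => Disjoint g.support h.support) ∧
    layers.foldl (fun φ l => l.foldl (fun φ' g => g.apply φ') φ) (ketZero N) = ψ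

/-! ### Measurement-based computation with a mod-2 linear side-processor -/

/-- An `l2`-MBQC with `n` input bits and an `N`-qubit resource state. -/
structure Protocol (n N : ℕ) where
  /-- the resource state -/
  state : Ket N
  state_norm : ∑ a, ‖state a‖ ^ 2 = 1
  /-- the observable measured on qubit `k` under setting `s` -/
  obs : Fin N → ZMod 2 → Op
  obs_hermitian : ∀ k s, (obs k s).IsHermitian
  obs_sq : ∀ k s, obs k s * obs k s = 1
  /-- both eigenvalues `1` and `-1` occur, so that the eigenbasis is determined -/
  obs_trace : ∀ k s, (obs k s).trace = 0
  /-- the preprocessing matrix `P` -/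
  pre : Matrix (Fin N) (Fin n) (ZMod 2)
  /-- the adaptation matrix `A` -/
  adapt : Matrix (Fin N) (Fin N) (ZMod 2)
  /-- for a suitable ordering of the qubits, each setting depends only on earlier outcomes -/
  causal : ∃ σ : Equiv.Perm (Fin N), ∀ j k, adapt j k ≠ 0 → σ k < σ j
  /-- the outcomes relevant for the output -/
  outMask : Bits N
  /-- the constant added to the output -/
  outConst : ZMod 2

namespace Protocol

variable {n N : ℕ}

/-- The measurement settings `s = P x ⊕ A m`. -/
def setting (M : Protocol n N) (x : Bits n) (m : Bits N) : Bits N :=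
  M.pre.mulVec x + M.adapt.mulVec m

/-- The computational output `y = oᵀ m ⊕ c`. -/
def output (M : Protocol n N) (m : Bits N) : ZMod 2 :=
  M.outMask ⬝ᵥ m + M.outConst

/-- The projection `(I + (-1)^m O) / 2` onto the eigenspace of `O` for the eigenvalue `(-1)^m`. -/
def eigenproj (O : Op) (m : ZMod 2) : Op := (1 / 2 : ℂ) • (1 + sgn m • O)

/-- The unnormalized state after the outcomes `m` were observed on input `x`: the tensor product
over all qubits `k` of the projections for outcome `m k` under the setting that `x` and `m`
dictate, applied to the resource state. -/
def postState (M : Protocol n N) (x : Bits n) (m : Bits N) : Ket N :=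
  fun a => ∑ b : Bits N,
    (∏ k, eigenproj (M.obs k (M.setting x m k)) (m k) (a k) (b k)) * M.state b

/-- The probability (Born rule) that the adaptive measurements on input `x` give the string of
outcomes `m`. -/
def prob (M : Protocol n N) (x : Bits n) (m : Bits N) : ℝ :=
  ∑ a, ‖M.postState x m a‖ ^ 2

/-- The probability that the computation outputs `y` on input `x`. -/
def outputProb (M : Protocol n N) (x : Bits n) (y : ZMod 2) : ℝ :=
  ∑ m : Bits N, if M.output m = y then M.prob x m else 0

/-- The protocol computes `f` deterministically: on every input `x` it outputs `f x` with
probability `1`. -/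
def Computes (M : Protocol n N) (f : Bits n → ZMod 2) : Prop :=
  ∀ x, M.outputProb x (f x) = 1

/-- The measurements can be done in `T` rounds: each qubit is assigned to a round, and its setting
depends only on the input and on outcomes from strictly earlier rounds. -/
def RunsInRounds (M : Protocol n N) (T : ℕ) : Prop :=
  ∃ r : Fin N → Fin T, ∀ j k, M.adapt j k ≠ 0 → r k < r j

/-- The number of distinct (not identically zero) parities of the input that the preprocessing
matrix outputs, that is, of distinct nonzero rows of `P`. -/
def numParities (M : Protocol n N) : ℕ :=
  ((Finset.univ.image fun k => M.pre k).erase 0).card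

/-- The outcomes enter all settings, and the output, through `b` running parity bits. Reading the
qubits along the chain, outcome `m k` is added to the bits selected by `u k`; the contribution
`(A m)_j` to the setting of qubit `j` is a parity (selected by `w j`) of the running bits just
before `j`, and the output is, up to the constant, a parity (selected by `v`) of their final
values. -/
def HasRunningBits (M : Protocol n N) (b : ℕ) : Prop :=
  ∃ (u w : Fin N → Bits b) (v : Bits b),
    (∀ (m : Bits N) (j : Fin N),
      M.adapt.mulVec m j = w j ⬝ᵥ ∑ k ∈ Finset.univ.filter (fun k => k < j), m k • u k) ∧
    ∀ m : Bits N, M.outMask ⬝ᵥ m = v ⬝ᵥ ∑ k, m k • u k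

/-- The side-processor uses `L` classical bits: the distinct parities of the input that the
preprocessing matrix outputs, together with the running parities of outcomes. -/
def UsesClassicalBits (M : Protocol n N) (L : ℕ) : Prop :=
  ∃ b, M.HasRunningBits b ∧ M.numParities + b = L

end Protocol

end

end L2MBQC

namespace L2MBQC

open Polynomial ComplexConjugate

/-! ### Fejér–Riesz factorization -/

/-! Measuring a cluster chain teleports `|+⟩` along it: angle `φ` applies a phase gate and a
Hadamard gate, up to Pauli byproducts fixed by the outcomes. An X byproduct reverses the angle that
follows, which a parity of earlier outcomes undoes, and the Hadamard gate exchanges X and Z. So two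
outcome parities, over even and over odd positions, suffice (`measuredState_eq`). By
`chainProtocol_prob` the output is deterministic once the byproduct-free state is a basis state.

Angle zero on alternate qubits cancels Hadamard gates, so angles add up along a block. With signs
given by the bits of `x` the sum is affine in the weight `|x|`; its step and offset are chosen so
that the signal is `τ = 2π (j - |x|) / p`. Then `z = exp (-iτ)` is a `p`-th root of unity, equal to
`1` exactly when `|x| ≡ j` (`exp_signal`). The last qubit of a block adds an X rotation independent
of the input (`idealState_eq_blockState`).

The average `A` of `1, z, ..., z ^ (p - 1)` is `1` at `z = 1` and `0` at the other roots of unity.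
Since `|A| ≤ 1` on the circle, `fejerRiesz` gives `B` with `|A|² + |B|² = 1`. Quantum signal
processing (`exists_reachable_polynomial`) reaches such pairs of polynomials by blocks. For `p ≥ 3`,
`p + 1` blocks are enough, and trivial blocks pad the chain. -/

lemma isPreconnected_unitCircle : IsPreconnected {z : ℂ | ‖z‖ = 1} := by
  have h := isPreconnected_sphere (E := ℂ) (by rw [Complex.rank_real_complex]; norm_num) 0 1
  convert h using 1
  ext z
  simp

lemma unitCircle_nontrivial : {z : ℂ | ‖z‖ = 1}.Nontrivial :=
  ⟨1, by simp, -1, by simp, by norm_num⟩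

lemma unitCircle_infinite : {z : ℂ | ‖z‖ = 1}.Infinite :=
  isPreconnected_unitCircle.infinite_of_nontrivial unitCircle_nontrivial

/-- Polynomials that agree on the unit circle are equal. -/
lemma eq_of_eval_eq_on_unitCircle {P Q : ℂ[X]} (h : ∀ z : ℂ, ‖z‖ = 1 → P.eval z = Q.eval z) :
    P = Q :=
  eq_of_infinite_eval_eq P Q (unitCircle_infinite.mono h)

lemma conj_mul_self_of_norm_one {z : ℂ} (hz : ‖z‖ = 1) : conj z * z = 1 := by
  rw [mul_comm, Complex.mul_conj, Complex.normSq_eq_norm_sq, hz]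
  norm_num

lemma conj_inv_of_norm_one {z : ℂ} (hz : ‖z‖ = 1) : (conj z)⁻¹ = z :=
  inv_eq_of_mul_eq_one_right (conj_mul_self_of_norm_one hz)

lemma ne_zero_of_norm_one {z : ℂ} (hz : ‖z‖ = 1) : z ≠ 0 := by
  rintro rfl
  simp at hz

/-- The conjugate reciprocal `z ^ d * conj (Q (1 / conj z))` of a polynomial `Q`. -/
noncomputable def conjReflect (d : ℕ) (Q : ℂ[X]) : ℂ[X] := reflect d (Q.map (starRingEnd ℂ))

lemma eval_conjReflect {d : ℕ} {Q : ℂ[X]} (hQ : Q.natDegree ≤ d) {z : ℂ} (hz : z ≠ 0) :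
    (conjReflect d Q).eval z = z ^ d * conj (Q.eval (conj z)⁻¹) := by
  let _ : Invertible z⁻¹ := invertibleOfNonzero (inv_ne_zero hz)
  have h := eval₂_reflect_mul_pow (RingHom.id ℂ) z⁻¹ d (Q.map (starRingEnd ℂ))
    (natDegree_map_le.trans hQ)
  rw [invOf_eq_inv, inv_inv] at h
  have h2 : eval₂ (RingHom.id ℂ) z⁻¹ (Q.map (starRingEnd ℂ)) = conj (Q.eval (conj z)⁻¹) := by
    have h3 : z⁻¹ = conj (conj z)⁻¹ := by simp
    rw [← eval, eval_map, h3, eval₂_at_apply]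
  rw [h2] at h
  rw [← h, conjReflect, eval, inv_pow, mul_left_comm, mul_inv_cancel₀ (pow_ne_zero d hz), mul_one]

lemma eval_conjReflect_of_norm_one {d : ℕ} {Q : ℂ[X]} (hQ : Q.natDegree ≤ d) {z : ℂ}
    (hz : ‖z‖ = 1) : (conjReflect d Q).eval z = z ^ d * conj (Q.eval z) := by
  rw [eval_conjReflect hQ (ne_zero_of_norm_one hz), conj_inv_of_norm_one hz]

lemma coeff_zero_conjReflect (d : ℕ) (Q : ℂ[X]) :
    (conjReflect d Q).coeff 0 = conj (Q.coeff d) := by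
  simp [conjReflect, coeff_reflect, revAt_le]

/-- A trigonometric polynomial `z ^ (-d) * Q z` that is nonnegative on the unit circle. -/
def NonnegOnCircle (d : ℕ) (Q : ℂ[X]) : Prop :=
  ∀ z : ℂ, ‖z‖ = 1 → ∃ c : ℝ, 0 ≤ c ∧ Q.eval z = c * z ^ d

/-- On the circle the reflection conjugates `z ^ (-d) * Q z`, which is real there. The resulting
symmetry pairs each nonzero root `r` with `1 / conj r`. -/
lemma NonnegOnCircle.conjReflect_eq {d : ℕ} {Q : ℂ[X]} (h : NonnegOnCircle d Q)
    (hd : Q.natDegree ≤ 2 * d) : conjReflect (2 * d) Q = Q := by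
  refine eq_of_eval_eq_on_unitCircle fun z hz => ?_
  obtain ⟨c, -, hc⟩ := h z hz
  rw [eval_conjReflect_of_norm_one hd hz, hc, map_mul, map_pow, Complex.conj_ofReal]
  have : z ^ d * conj z ^ d = 1 := by
    rw [← mul_pow, mul_comm, conj_mul_self_of_norm_one hz, one_pow]
  linear_combination (c : ℂ) * z ^ d * this

/-- A root on the unit circle of a nonnegative trigonometric polynomial is a multiple root. -/
lemma NonnegOnCircle.double_root {d : ℕ} {Q R : ℂ[X]} (h : NonnegOnCircle d Q) {r : ℂ}
    (hr : ‖r‖ = 1) (hQ : Q = (X - C r) * R) : R.eval r = 0 := by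
  have hr0 := ne_zero_of_norm_one hr
  let e : ℂ → ℂ := fun w => Complex.exp (Complex.I * w)
  -- For real `t` and `z = r * e t`, the product `(r * e t - r) * g t` is `Q z / z ^ d`: real,
  -- nonnegative, and zero at `t = 0`. Its derivative `r * I * g 0` there has zero real part by
  -- minimality and zero imaginary part by constancy.
  let g : ℂ → ℂ := fun w => R.eval (r * e w) * (r ^ d)⁻¹ * Complex.exp (-(d * (Complex.I * w)))
  have hg : DifferentiableAt ℂ g 0 := by
    have h1 : Differentiable ℂ fun w => R.eval (r * e w) :=
      R.differentiable.comp (by fun_prop)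
    have h2 : Differentiable ℂ g := by
      refine (h1.mul_const _).mul ?_
      fun_prop
    exact h2 0
  have he : HasDerivAt (fun w => r * e w - r) (r * Complex.I) 0 := by
    have h1 : HasDerivAt (fun w : ℂ => Complex.I * w) Complex.I 0 := by
      simpa using (hasDerivAt_id (0 : ℂ)).const_mul Complex.I
    simpa using (h1.cexp.const_mul r).sub_const r
  have hF := he.mul hg.hasDerivAt
  have hF0 : HasDerivAt (fun t : ℝ => (r * e t - r) * g t) (r * Complex.I * g 0) 0 := by
    have h3 := HasDerivAt.comp_ofReal (z := 0) (by simpa using hF)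
    simpa [e] using h3
  have hval : ∀ t : ℝ, ∃ c : ℝ, 0 ≤ c ∧ (r * e t - r) * g t = c := by
    intro t
    have hen : ‖e t‖ = 1 := by
      simp only [e]
      rw [mul_comm]
      exact Complex.norm_exp_ofReal_mul_I t
    obtain ⟨c, hc, hc'⟩ := h (r * e t) (by rw [norm_mul, hr, hen, one_mul])
    refine ⟨c, hc, ?_⟩
    rw [hQ, eval_mul, eval_sub, eval_X, eval_C] at hc'
    have hee : e t ^ d * Complex.exp (-(d * (Complex.I * t))) = 1 := by
      simp only [e]
      rw [← Complex.exp_nat_mul, ← Complex.exp_add, add_neg_cancel, Complex.exp_zero]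
    calc (r * e t - r) * g t
        = ((r * e t - r) * R.eval (r * e t)) * (r ^ d)⁻¹
            * Complex.exp (-(d * (Complex.I * t))) := by simp only [g]; ring
      _ = c * (r ^ d * (r ^ d)⁻¹) * (e t ^ d * Complex.exp (-(d * (Complex.I * t)))) := by
          rw [hc']; ring
      _ = c := by rw [hee, mul_inv_cancel₀ (pow_ne_zero _ hr0)]; ring
  have hre : (r * Complex.I * g 0).re = 0 := by
    have hd1 : HasDerivAt (fun t : ℝ => ((r * e t - r) * g t).re) (r * Complex.I * g 0).re 0 := by
      exact (Complex.reCLM.hasFDerivAt.comp_hasDerivAt (0 : ℝ) hF0)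
    refine IsLocalMin.hasDerivAt_eq_zero (Filter.Eventually.of_forall fun t => ?_) hd1
    obtain ⟨c, hc, hc'⟩ := hval t
    rw [hc']
    simpa [e] using hc
  have him : (r * Complex.I * g 0).im = 0 := by
    have hd1 : HasDerivAt (fun t : ℝ => ((r * e t - r) * g t).im) (r * Complex.I * g 0).im 0 := by
      exact (Complex.imCLM.hasFDerivAt.comp_hasDerivAt (0 : ℝ) hF0)
    have h0 : (fun t : ℝ => ((r * e t - r) * g t).im) = fun _ => 0 := by
      funext t
      obtain ⟨c, hc, hc'⟩ := hval t
      rw [hc', Complex.ofReal_im]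
    rw [h0] at hd1
    exact hd1.unique (hasDerivAt_const _ _)
  have h0 : r * Complex.I * g 0 = 0 := Complex.ext hre him
  simpa [g, e, hr0] using h0

/-- Nonnegativity on the unit circle with one point removed extends to that point. -/
lemma NonnegOnCircle.of_ne {d : ℕ} {Q : ℂ[X]} (r : ℂ)
    (h : ∀ z : ℂ, ‖z‖ = 1 → z ≠ r → ∃ c : ℝ, 0 ≤ c ∧ Q.eval z = c * z ^ d) :
    NonnegOnCircle d Q := by
  intro z hz
  have hpow : ∀ w : ℂ, ‖w‖ = 1 → w ^ d * conj w ^ d = 1 := fun w hw => by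
    rw [← mul_pow, mul_comm, conj_mul_self_of_norm_one hw, one_pow]
  let f : ℂ → ℂ := fun w => Q.eval w * conj w ^ d
  have hf : Continuous f := by
    have := Complex.continuous_conj
    have := Q.continuous
    fun_prop
  have hS : IsClosed {w : ℂ | 0 ≤ (f w).re ∧ (f w).im = 0} :=
    (isClosed_le continuous_const (Complex.continuous_re.comp hf)).inter
      (isClosed_eq (Complex.continuous_im.comp hf) continuous_const)
  have hsub : {w : ℂ | ‖w‖ = 1} \ {r} ⊆ {w : ℂ | 0 ≤ (f w).re ∧ (f w).im = 0} := by
    rintro w ⟨hw, hwr⟩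
    obtain ⟨c, hc, hc'⟩ := h w hw hwr
    have : f w = c := by
      simp only [f, hc']
      rw [mul_assoc, hpow w hw, mul_one]
    simp [this, hc]
  -- The circle is connected with more than one point, so `r` is not isolated in it.
  have hmem : z ∈ closure ({w : ℂ | ‖w‖ = 1} \ {r}) := by
    by_cases hzr : z = r
    · subst hzr
      have := isPreconnected_unitCircle.preperfect_of_nontrivial unitCircle_nontrivial z hz
      rw [accPt_principal_iff_clusterPt] at this
      exact mem_closure_iff_clusterPt.2 this
    · exact subset_closure ⟨hz, hzr⟩
  obtain ⟨h1, h2⟩ := closure_minimal hsub hS hmem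
  refine ⟨(f z).re, h1, ?_⟩
  have h3 : ((f z).re : ℂ) = f z := Complex.ext (by simp) (by simp [h2])
  rw [h3]
  simp only [f]
  linear_combination -Q.eval z * hpow z hz

/-- **Fejér–Riesz**: a nonnegative trigonometric polynomial is a squared modulus. -/
theorem fejerRiesz (d : ℕ) : ∀ Q : ℂ[X], Q.natDegree ≤ 2 * d → NonnegOnCircle d Q →
    ∃ B : ℂ[X], B.natDegree ≤ d ∧
      ∀ z : ℂ, ‖z‖ = 1 → Q.eval z = ((‖B.eval z‖ ^ 2 : ℝ) : ℂ) * z ^ d := by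
  induction d with
  | zero =>
    intro Q hQ h
    obtain ⟨q, rfl⟩ := natDegree_eq_zero.1 (Nat.le_zero.1 hQ)
    obtain ⟨c, hc, hc'⟩ := h 1 (by simp)
    simp only [eval_C, pow_zero, mul_one] at hc'
    refine ⟨C (Real.sqrt c : ℂ), by simp, fun z _ => ?_⟩
    simp only [eval_C, pow_zero, mul_one, hc', Complex.norm_real, Real.norm_eq_abs, sq_abs,
      Real.sq_sqrt hc]
  | succ d ih =>
    intro Q hQ h
    have hsymm := h.conjReflect_eq hQ
    have htop : Q.coeff 0 = conj (Q.coeff (2 * (d + 1))) := by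
      conv_lhs => rw [← hsymm]
      rw [coeff_zero_conjReflect]
    -- If the constant coefficient vanishes, symmetry kills the top one too, and division by `X`
    -- lowers `d` by one.
    by_cases h0 : Q.coeff 0 = 0
    · have htop0 : Q.coeff (2 * (d + 1)) = 0 := by simpa [h0] using htop.symm
      have hX : Q = X * Q.divX := by
        conv_lhs => rw [← X_mul_divX_add Q, h0]
        simp
      have hdeg : Q.natDegree ≤ 2 * d + 1 := by
        by_contra hlt
        have : Q.natDegree = 2 * (d + 1) := by omega
        have hQ0 : Q = 0 := by rw [← leadingCoeff_eq_zero, leadingCoeff, this, htop0]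
        rw [hQ0] at hlt
        simp at hlt
      obtain ⟨B, hB, hB'⟩ := ih Q.divX
        (by rw [natDegree_divX_eq_natDegree_tsub_one]; omega) (by
          intro z hz
          obtain ⟨c, hc, hc'⟩ := h z hz
          refine ⟨c, hc, mul_left_cancel₀ (ne_zero_of_norm_one hz) ?_⟩
          rw [hX, eval_mul, eval_X] at hc'
          rw [hc']; ring)
      refine ⟨B, by omega, fun z hz => ?_⟩
      rw [hX, eval_mul, eval_X, hB' z hz]
      ring
    · have htop0 : Q.coeff (2 * (d + 1)) ≠ 0 := fun h' => h0 (by simpa [h'] using htop)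
      have hdeg : Q.natDegree = 2 * (d + 1) :=
        le_antisymm hQ (le_natDegree_of_ne_zero htop0)
      have hQ0 : Q ≠ 0 := by rintro rfl; simp at h0
      obtain ⟨r, hr⟩ := Complex.exists_root (f := Q)
        (natDegree_pos_iff_degree_pos.1 (by omega))
      have hr0 : r ≠ 0 := by
        rintro rfl
        exact h0 (by rw [coeff_zero_eq_eval_zero]; exact hr)
      -- The reflected root `w` is split off as well. It equals `r` when `r` lies on the circle,
      -- where `double_root` supplies the second factor.
      obtain ⟨R, hR⟩ := dvd_iff_isRoot.2 hr
      set w : ℂ := (conj r)⁻¹ with hw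
      have hw0 : w ≠ 0 := inv_ne_zero (by simpa using hr0)
      have hRw : R.IsRoot w := by
        by_cases hn : ‖r‖ = 1
        · rw [hw, conj_inv_of_norm_one hn]
          exact h.double_root hn hR
        · have hwr : w - r ≠ 0 := by
            intro h'
            have h1 : conj r * r = 1 := by
              have h2 : conj r * w = 1 := mul_inv_cancel₀ (by simpa using hr0)
              rwa [sub_eq_zero.1 h'] at h2
            rw [mul_comm, Complex.mul_conj, Complex.normSq_eq_norm_sq] at h1
            have h2 : ‖r‖ ^ 2 = 1 := by exact_mod_cast h1
            exact hn (by nlinarith [norm_nonneg r])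
          have h1 : Q.eval w = 0 := by
            conv_lhs => rw [← hsymm]
            rw [eval_conjReflect hQ hw0]
            have : (conj w)⁻¹ = r := by simp [hw]
            rw [this, hr.eq_zero]
            simp
          rw [hR, eval_mul, eval_sub, eval_X, eval_C] at h1
          exact (mul_eq_zero.1 h1).resolve_left hwr
      obtain ⟨S, hS⟩ := dvd_iff_isRoot.2 hRw
      have hQS : Q = (X - C r) * ((X - C w) * S) := by rw [hR, hS]
      have hS0 : S ≠ 0 := by rintro rfl; simp at hQS; exact hQ0 hQS
      have hSdeg : S.natDegree ≤ 2 * d := by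
        have := hdeg
        rw [hQS, natDegree_mul (X_sub_C_ne_zero r) (mul_ne_zero (X_sub_C_ne_zero w) hS0),
          natDegree_mul (X_sub_C_ne_zero w) hS0, natDegree_X_sub_C, natDegree_X_sub_C] at this
        omega
      -- On the circle `z - w = -w * z * conj (z - r)`. Dividing by `‖z - r‖ ^ 2` preserves
      -- nonnegativity except possibly at `r`, which `NonnegOnCircle.of_ne` handles.
      have hkey : ∀ z : ℂ, ‖z‖ = 1 →
          Q.eval z = ((‖z - r‖ ^ 2 : ℝ) : ℂ) * z * (C (-w) * S).eval z := by
        intro z hz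
        have h1 : ((‖z - r‖ ^ 2 : ℝ) : ℂ) = (z - r) * (conj z - conj r) := by
          rw [← Complex.normSq_eq_norm_sq, ← Complex.mul_conj, map_sub]
        have h2 : conj r * w = 1 := mul_inv_cancel₀ (by simpa using hr0)
        have h3 := conj_mul_self_of_norm_one hz
        rw [h1, hQS]
        simp only [eval_mul, eval_sub, eval_X, eval_C]
        linear_combination (-(z - r) * S.eval z * z) * h2 + (z - r) * w * S.eval z * h3
      obtain ⟨B, hB, hB'⟩ := ih (C (-w) * S) ((natDegree_C_mul_le _ _).trans hSdeg)
        (NonnegOnCircle.of_ne r fun z hz hzr => by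
          obtain ⟨c, hc, hc'⟩ := h z hz
          have hzr' : ((‖z - r‖ ^ 2 : ℝ) : ℂ) ≠ 0 := by
            simpa [sub_eq_zero] using hzr
          refine ⟨c / ‖z - r‖ ^ 2, by positivity, ?_⟩
          rw [hkey z hz] at hc'
          refine mul_left_cancel₀ (mul_ne_zero hzr' (ne_zero_of_norm_one hz)) ?_
          rw [hc', Complex.ofReal_div]
          field_simp
          ring)
      refine ⟨(X - C r) * B, ?_, fun z hz => ?_⟩
      · refine natDegree_mul_le.trans ?_
        rw [natDegree_X_sub_C]
        omega
      · rw [hkey z hz, hB' z hz]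
        simp only [eval_mul, eval_sub, eval_X, eval_C, norm_mul, mul_pow, Complex.ofReal_mul]
        ring

end L2MBQC

namespace L2MBQC

open Polynomial ComplexConjugate

/-! ### Single-qubit gates -/

lemma zmod_two_cases (b : ZMod 2) : b = 0 ∨ b = 1 := by
  revert b
  decide

lemma sum_zmod_two {M : Type*} [AddCommMonoid M] (f : ZMod 2 → M) : ∑ b, f b = f 0 + f 1 :=
  Fin.sum_univ_two f

lemma funext_zmod_two {M : Type*} {v w : ZMod 2 → M} (h0 : v 0 = w 0) (h1 : v 1 = w 1) :
    v = w := by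
  funext b
  rcases zmod_two_cases b with rfl | rfl
  exacts [h0, h1]

lemma sgn_zero : sgn 0 = 1 := by simp [sgn]

lemma sgn_one : sgn 1 = -1 := by simp [sgn]

lemma norm_sgn (m : ZMod 2) : ‖sgn m‖ = 1 := by
  rcases zmod_two_cases m with rfl | rfl <;> simp [sgn_zero, sgn_one]

noncomputable section

/-- The phase gate `diag (1, exp (-iθ))`. -/
def phaseGate (θ : ℝ) (v : ZMod 2 → ℂ) : ZMod 2 → ℂ :=
  fun b => (if b = 0 then 1 else Complex.exp (-(θ * Complex.I))) * v b

/-- The Hadamard gate on single-qubit states. -/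
def hadGate (v : ZMod 2 → ℂ) : ZMod 2 → ℂ := hadamard.mulVec v

/-- The phase gate in the `X` basis. -/
def xGate (β : ℝ) (v : ZMod 2 → ℂ) : ZMod 2 → ℂ := hadGate (phaseGate β (hadGate v))

lemma phaseGate_apply_zero (θ : ℝ) (v : ZMod 2 → ℂ) : phaseGate θ v 0 = v 0 := by
  simp [phaseGate]

lemma phaseGate_apply_one (θ : ℝ) (v : ZMod 2 → ℂ) :
    phaseGate θ v 1 = Complex.exp (-(θ * Complex.I)) * v 1 := by
  simp [phaseGate]

lemma hadGate_apply (v : ZMod 2 → ℂ) (c : ZMod 2) :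
    hadGate v c = (v 0 + sgn c * v 1) / (Real.sqrt 2 : ℂ) := by
  simp only [hadGate, Matrix.mulVec, dotProduct, sum_zmod_two, hadamard, Matrix.of_apply,
    mul_zero, mul_one, sgn_zero]
  ring

lemma sqrt_two_mul_self : (Real.sqrt 2 : ℂ) * (Real.sqrt 2 : ℂ) = 2 := by
  rw [← Complex.ofReal_mul, Real.mul_self_sqrt (by norm_num)]
  norm_num

lemma sqrt_two_ne_zero : (Real.sqrt 2 : ℂ) ≠ 0 := by
  intro h
  have := sqrt_two_mul_self
  rw [h] at this
  norm_num at this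

lemma hadGate_hadGate (v : ZMod 2 → ℂ) : hadGate (hadGate v) = v := by
  have h := sqrt_two_mul_self
  have h0 := sqrt_two_ne_zero
  apply funext_zmod_two <;> simp only [hadGate_apply, sgn_zero, sgn_one] <;> field_simp <;>
    rw [pow_two, h] <;> ring

lemma phaseGate_phaseGate (a b : ℝ) (v : ZMod 2 → ℂ) :
    phaseGate a (phaseGate b v) = phaseGate (a + b) v := by
  apply funext_zmod_two
  · simp only [phaseGate_apply_zero]
  · simp only [phaseGate_apply_one]
    rw [← mul_assoc, ← Complex.exp_add]
    push_cast
    ring_nf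

lemma phaseGate_zero (v : ZMod 2 → ℂ) : phaseGate 0 v = v := by
  apply funext_zmod_two <;> simp [phaseGate_apply_zero, phaseGate_apply_one]

lemma phaseGate_neg_cancel (a : ℝ) (v : ZMod 2 → ℂ) : phaseGate a (phaseGate (-a) v) = v := by
  rw [phaseGate_phaseGate, add_neg_cancel, phaseGate_zero]

lemma xGate_zero (v : ZMod 2 → ℂ) : xGate 0 v = v := by
  rw [xGate, phaseGate_zero, hadGate_hadGate]

lemma xGate_xGate (a b : ℝ) (v : ZMod 2 → ℂ) : xGate a (xGate b v) = xGate (a + b) v := by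
  simp only [xGate, hadGate_hadGate, phaseGate_phaseGate]

lemma xGate_neg_cancel (a : ℝ) (v : ZMod 2 → ℂ) : xGate a (xGate (-a) v) = v := by
  rw [xGate_xGate, add_neg_cancel, xGate_zero]

lemma hadGate_smul (κ : ℂ) (v : ZMod 2 → ℂ) : hadGate (κ • v) = κ • hadGate v :=
  Matrix.mulVec_smul _ _ _

lemma phaseGate_smul (θ : ℝ) (κ : ℂ) (v : ZMod 2 → ℂ) :
    phaseGate θ (κ • v) = κ • phaseGate θ v := by
  funext b
  simp only [phaseGate, Pi.smul_apply, smul_eq_mul]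
  ring

lemma xGate_smul (β : ℝ) (κ : ℂ) (v : ZMod 2 → ℂ) : xGate β (κ • v) = κ • xGate β v := by
  simp only [xGate, hadGate_smul, phaseGate_smul]

lemma xGate_apply_zero (β : ℝ) (v : ZMod 2 → ℂ) :
    xGate β v 0 = (1 + Complex.exp (-(β * Complex.I))) / 2 * v 0 +
      (1 - Complex.exp (-(β * Complex.I))) / 2 * v 1 := by
  have h := sqrt_two_mul_self
  have h0 := sqrt_two_ne_zero
  simp only [xGate, hadGate_apply, phaseGate_apply_zero, phaseGate_apply_one, sgn_zero, sgn_one]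
  field_simp
  rw [pow_two, h]
  ring

lemma xGate_apply_one (β : ℝ) (v : ZMod 2 → ℂ) :
    xGate β v 1 = (1 - Complex.exp (-(β * Complex.I))) / 2 * v 0 +
      (1 + Complex.exp (-(β * Complex.I))) / 2 * v 1 := by
  have h := sqrt_two_mul_self
  have h0 := sqrt_two_ne_zero
  simp only [xGate, hadGate_apply, phaseGate_apply_zero, phaseGate_apply_one, sgn_zero, sgn_one]
  field_simp
  rw [pow_two, h]
  ring

lemma norm_exp_neg_mul_I (θ : ℝ) : ‖Complex.exp (-(θ * Complex.I))‖ = 1 := by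
  have := Complex.norm_exp_ofReal_mul_I (-θ)
  rwa [Complex.ofReal_neg, neg_mul] at this

lemma normSq_phaseGate (θ : ℝ) (v : ZMod 2 → ℂ) :
    ‖phaseGate θ v 0‖ ^ 2 + ‖phaseGate θ v 1‖ ^ 2 = ‖v 0‖ ^ 2 + ‖v 1‖ ^ 2 := by
  rw [phaseGate_apply_zero, phaseGate_apply_one, norm_mul, norm_exp_neg_mul_I, one_mul]

lemma normSq_hadGate (v : ZMod 2 → ℂ) :
    ‖hadGate v 0‖ ^ 2 + ‖hadGate v 1‖ ^ 2 = ‖v 0‖ ^ 2 + ‖v 1‖ ^ 2 := by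
  have h := parallelogram_law_with_norm ℝ (v 0) (v 1)
  have h2 : ‖(Real.sqrt 2 : ℂ)‖ ^ 2 = 2 := by
    rw [Complex.norm_real, Real.norm_eq_abs, sq_abs, Real.sq_sqrt (by norm_num)]
  simp only [hadGate_apply, sgn_zero, sgn_one, one_mul, neg_mul, ← sub_eq_add_neg, norm_div,
    div_pow, h2]
  linarith

lemma normSq_xGate (β : ℝ) (v : ZMod 2 → ℂ) :
    ‖xGate β v 0‖ ^ 2 + ‖xGate β v 1‖ ^ 2 = ‖v 0‖ ^ 2 + ‖v 1‖ ^ 2 := by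
  rw [xGate, normSq_hadGate, normSq_phaseGate, normSq_hadGate]

/-- The vector with the given two entries. -/
def pair (x y : ℂ) : ZMod 2 → ℂ := fun b => if b = 0 then x else y

@[simp] lemma pair_zero (x y : ℂ) : pair x y 0 = x := by simp [pair]

@[simp] lemma pair_one (x y : ℂ) : pair x y 1 = y := by simp [pair]

/-! ### Quantum signal processing -/

/-- The state `|+⟩`. -/
def plusVec : ZMod 2 → ℂ := fun _ => 1 / (Real.sqrt 2 : ℂ)

/-- The state after `t` blocks, each a phase gate (with a part proportional to the signal `τ`)
followed by a phase gate in the `X` basis. -/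
def blockState (c σ β : ℕ → ℝ) (τ : ℝ) : ℕ → ZMod 2 → ℂ
  | 0 => plusVec
  | t + 1 => xGate (β t) (phaseGate (c t + σ t * τ) (blockState c σ β τ t))

lemma blockState_congr {c σ β c' σ' β' : ℕ → ℝ} (τ : ℝ) (T : ℕ)
    (hc : ∀ t < T, c t = c' t) (hs : ∀ t < T, σ t = σ' t) (hb : ∀ t < T, β t = β' t) :
    blockState c σ β τ T = blockState c' σ' β' τ T := by
  induction T with
  | zero => rfl
  | succ T ih =>
    simp only [blockState]
    rw [ih (fun t ht => hc t (by omega)) (fun t ht => hs t (by omega))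
      (fun t ht => hb t (by omega)), hc T (by omega), hs T (by omega), hb T (by omega)]

/-- The state `f τ` is obtained from `|+⟩` by `T` blocks with signal `τ`. -/
def Reachable (T : ℕ) (f : ℝ → ZMod 2 → ℂ) : Prop :=
  ∃ c σ β : ℕ → ℝ, (∀ t, T ≤ t → c t = 0 ∧ σ t = 0 ∧ β t = 0) ∧
    ∀ τ, f τ = blockState c σ β τ T

lemma reachable_zero : Reachable 0 fun _ => plusVec :=
  ⟨0, 0, 0, by simp, fun _ => rfl⟩

lemma Reachable.step {T : ℕ} {f : ℝ → ZMod 2 → ℂ} (h : Reachable T f) (c σ β : ℝ) :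
    Reachable (T + 1) fun τ => xGate β (phaseGate (c + σ * τ) (f τ)) := by
  obtain ⟨c', σ', β', h0, hf⟩ := h
  refine ⟨Function.update c' T c, Function.update σ' T σ, Function.update β' T β, ?_, ?_⟩
  · intro t ht
    have hT : t ≠ T := by omega
    simpa [Function.update_of_ne hT] using h0 t (by omega)
  · intro τ
    simp only [blockState, Function.update_self]
    rw [hf τ]
    congr 2
    apply blockState_congr <;> intro t ht <;> rw [Function.update_of_ne (by omega)]

/-- The zero tail required in `Reachable` makes all later blocks trivial, so a sequence can be
padded to the length of the chain. -/
lemma Reachable.exists_forall_le {T : ℕ} {f : ℝ → ZMod 2 → ℂ} (h : Reachable T f) :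
    ∃ c σ β : ℕ → ℝ, (∀ t, T ≤ t → c t = 0 ∧ σ t = 0 ∧ β t = 0) ∧
      ∀ τ, ∀ T', T ≤ T' → blockState c σ β τ T' = f τ := by
  obtain ⟨c, σ, β, h0, hf⟩ := h
  refine ⟨c, σ, β, h0, fun τ T' hT => ?_⟩
  induction T', hT using Nat.le_induction with
  | base => exact (hf τ).symm
  | succ t ht ih =>
    obtain ⟨h1, h2, h3⟩ := h0 t ht
    simp [blockState, h1, h2, h3, phaseGate_zero, xGate_zero, ih]

/-- The lines in `ℂ²` reached from the first basis vector by an `X` rotation followed by a `Z`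
rotation are all lines. -/
lemma exists_angles_parallel (w0 w1 : ℂ) : ∃ α β : ℝ,
    w1 * (1 + Complex.exp (-(β * Complex.I))) =
      w0 * (Complex.exp (-(α * Complex.I)) * (1 - Complex.exp (-(β * Complex.I)))) := by
  -- The half-angle `φ` has cosine and sine proportional to `‖w0‖` and `‖w1‖`. The angle `α` matches
  -- the relative phase; its `π / 2` absorbs the `I` in `1 - exp (-2iφ) = 2 I sin φ exp (-iφ)`.
  set q : ℂ := (‖w0‖ : ℂ) + ‖w1‖ * Complex.I with hq
  set φ : ℝ := q.arg with hφ
  set α : ℝ := w0.arg + Real.pi / 2 - w1.arg with hα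
  refine ⟨α, 2 * φ, ?_⟩
  have hf : Complex.exp (-(α * Complex.I)) * Complex.I =
      Complex.exp (w1.arg * Complex.I) * (Complex.exp (w0.arg * Complex.I))⁻¹ := by
    rw [← Complex.exp_neg, ← Complex.exp_add]
    nth_rw 2 [← Complex.exp_pi_div_two_mul_I]
    rw [← Complex.exp_add]
    congr 1
    rw [hα]
    push_cast
    ring
  have hexp : Complex.exp (-((2 * φ : ℝ) * Complex.I)) =
      Complex.exp (-(φ * Complex.I)) * Complex.exp (-(φ * Complex.I)) := by
    rw [← Complex.exp_add]
    push_cast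
    ring_nf
  have hinv : Complex.exp (-(φ * Complex.I)) * Complex.exp (φ * Complex.I) = 1 := by
    rw [← Complex.exp_add, neg_add_cancel, Complex.exp_zero]
  have hcos : (1 : ℂ) + Complex.exp (-((2 * φ : ℝ) * Complex.I)) =
      Complex.exp (-(φ * Complex.I)) * (2 * (Real.cos φ : ℂ)) := by
    rw [hexp, Complex.ofReal_cos, Complex.two_cos, neg_mul]
    linear_combination -hinv
  have hsin : (1 : ℂ) - Complex.exp (-((2 * φ : ℝ) * Complex.I)) =
      Complex.exp (-(φ * Complex.I)) * (2 * (Real.sin φ : ℂ)) * Complex.I := by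
    rw [hexp, Complex.ofReal_sin, Complex.two_sin, neg_mul]
    linear_combination -hinv + (Complex.exp (-(φ * Complex.I)) * Complex.exp (φ * Complex.I)
      - Complex.exp (-(φ * Complex.I)) * Complex.exp (-(φ * Complex.I))) * Complex.I_sq
  have hc : ‖q‖ * Real.cos φ = ‖w0‖ := by
    rw [hφ, Complex.norm_mul_cos_arg]
    simp [hq]
  have hs : ‖q‖ * Real.sin φ = ‖w1‖ := by
    rw [hφ, Complex.norm_mul_sin_arg]
    simp [hq]
  by_cases hq0 : ‖q‖ = 0
  · rw [hq0, zero_mul] at hc hs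
    rw [norm_eq_zero.1 hc.symm, norm_eq_zero.1 hs.symm]
    simp
  have hc' : (‖q‖ : ℂ) * (Real.cos φ : ℂ) = ‖w0‖ := by exact_mod_cast hc
  have hs' : (‖q‖ : ℂ) * (Real.sin φ : ℂ) = ‖w1‖ := by exact_mod_cast hs
  have h0 := Complex.norm_mul_exp_arg_mul_I w0
  have h1 := Complex.norm_mul_exp_arg_mul_I w1
  have hE := mul_inv_cancel₀ (Complex.exp_ne_zero (w0.arg * Complex.I))
  rw [hcos, hsin]
  have hq0' : (‖q‖ : ℂ) ≠ 0 := by exact_mod_cast hq0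
  refine mul_left_cancel₀ hq0' ?_
  calc (‖q‖ : ℂ) * (w1 * (Complex.exp (-(φ * Complex.I)) * (2 * (Real.cos φ : ℂ))))
      = w1 * (2 * Complex.exp (-(φ * Complex.I))) * ((‖q‖ : ℂ) * (Real.cos φ : ℂ)) := by ring
    _ = (‖w1‖ * Complex.exp (w1.arg * Complex.I)) * (2 * Complex.exp (-(φ * Complex.I)))
          * ‖w0‖ := by rw [hc', h1]
    _ = (‖w0‖ * (Complex.exp (w0.arg * Complex.I) * (Complex.exp (w0.arg * Complex.I))⁻¹)) *
          (Complex.exp (w1.arg * Complex.I)) * (2 * Complex.exp (-(φ * Complex.I))) * ‖w1‖ := by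
        rw [hE]; ring
    _ = (‖w0‖ * Complex.exp (w0.arg * Complex.I)) *
          (Complex.exp (w1.arg * Complex.I) * (Complex.exp (w0.arg * Complex.I))⁻¹) *
          (2 * Complex.exp (-(φ * Complex.I))) * ‖w1‖ := by ring
    _ = w0 * (Complex.exp (-(α * Complex.I)) * Complex.I) *
          (2 * Complex.exp (-(φ * Complex.I))) * ((‖q‖ : ℂ) * (Real.sin φ : ℂ)) := by
        rw [h0, hf, hs']
    _ = _ := by ring

/-- Two orthogonal vectors in `ℂ²` are rotated onto the coordinate axes by a `Z` rotation followed
by an `X` rotation. -/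
lemma exists_angles_orthogonal {u v : ZMod 2 → ℂ}
    (h : u 0 * conj (v 0) + u 1 * conj (v 1) = 0) : ∃ α β : ℝ,
    xGate (-β) (phaseGate (-α) u) 1 = 0 ∧ xGate (-β) (phaseGate (-α) v) 0 = 0 := by
  -- It is enough to rotate one nonzero `w`, parallel to `u` and orthogonal to `v`; the cases allow
  -- for `u` or `v` being zero.
  obtain ⟨w0, w1, hw, hu, hv⟩ : ∃ w0 w1 : ℂ, (w0 ≠ 0 ∨ w1 ≠ 0) ∧ w0 * u 1 = w1 * u 0 ∧
      conj w0 * v 0 + conj w1 * v 1 = 0 := by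
    by_cases hu : u 0 ≠ 0 ∨ u 1 ≠ 0
    · refine ⟨u 0, u 1, hu, mul_comm _ _, ?_⟩
      have := congrArg conj h
      simpa using this
    · simp only [not_or, not_not] at hu
      by_cases hv : v 0 ≠ 0 ∨ v 1 ≠ 0
      · refine ⟨-conj (v 1), conj (v 0), ?_, by simp [hu.1, hu.2], ?_⟩
        · rcases hv with hv | hv
          · right; simpa using hv
          · left; simpa using hv
        · simp; ring
      · simp only [not_or, not_not] at hv
        exact ⟨1, 0, by simp, by simp [hu.1, hu.2], by simp [hv.1, hv.2]⟩
  obtain ⟨α, β, hαβ⟩ := exists_angles_parallel w0 w1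
  refine ⟨α, β, ?_⟩
  simp only [xGate_apply_zero, xGate_apply_one, phaseGate_apply_zero, phaseGate_apply_one,
    Complex.ofReal_neg, neg_mul, neg_neg]
  have hconj : ∀ θ : ℝ, conj (Complex.exp (-(θ * Complex.I))) = Complex.exp (θ * Complex.I) := by
    intro θ
    rw [← Complex.exp_conj]
    simp
  have hinv : ∀ θ : ℝ, Complex.exp (-(θ * Complex.I)) * Complex.exp (θ * Complex.I) = 1 := by
    intro θ
    rw [← Complex.exp_add, neg_add_cancel, Complex.exp_zero]
  have hbar := congrArg conj hαβ
  simp only [map_mul, map_add, map_sub, map_one, hconj] at hbar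
  have hα := hinv α
  have hβ := hinv β
  have hE0 := Complex.exp_ne_zero (-(β * Complex.I))
  have hF0 := Complex.exp_ne_zero (-(α * Complex.I))
  generalize Complex.exp (-(α * Complex.I)) = F at *
  generalize Complex.exp (-(β * Complex.I)) = E at *
  generalize Complex.exp (α * Complex.I) = F' at *
  generalize Complex.exp (β * Complex.I) = E' at *
  constructor
  -- Multiplying by `E * F` clears the inverses `E'` and `F'`; a nonzero entry of `w` is then
  -- cancelled.
  · refine (mul_eq_zero.1 (?_ : E * F * _ = 0)).resolve_left (mul_ne_zero hE0 hF0)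
    have e1 : E * F * ((1 - E') / 2 * u 0 + (1 + E') / 2 * (F' * u 1)) =
        ((E - 1) * F * u 0 + (E + 1) * u 1) / 2 := by
      linear_combination (-(F * u 0) / 2 + F * F' * u 1 / 2) * hβ + (E * u 1 / 2 + u 1 / 2) * hα
    rw [e1]
    rcases hw with hw | hw
    · refine (mul_eq_zero.1 (?_ : w0 * _ = 0)).resolve_left hw
      linear_combination (E + 1) / 2 * hu + u 0 / 2 * hαβ
    · refine (mul_eq_zero.1 (?_ : w1 * _ = 0)).resolve_left hw
      linear_combination (1 - E) * F / 2 * hu + u 1 / 2 * hαβ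
  · refine (mul_eq_zero.1 (?_ : E * F * _ = 0)).resolve_left (mul_ne_zero hE0 hF0)
    have e1 : E * F * ((1 + E') / 2 * v 0 + (1 - E') / 2 * (F' * v 1)) =
        ((E + 1) * F * v 0 + (E - 1) * v 1) / 2 := by
      linear_combination (F * v 0 / 2 - F * F' * v 1 / 2) * hβ + (E * v 1 / 2 - v 1 / 2) * hα
    have hbar' : F * (E + 1) * conj w1 = (E - 1) * conj w0 := by
      linear_combination F * E * hbar - (F * conj w1 + F * F' * conj w0) * hβ
        + conj w0 * (E - 1) * hα
    rw [e1]
    rcases hw with hw | hw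
    · refine (mul_eq_zero.1 (?_ : conj w0 * _ = 0)).resolve_left (by simpa using hw)
      linear_combination (E + 1) * F / 2 * hv - v 1 / 2 * hbar'
    · refine (mul_eq_zero.1 (?_ : conj w1 * _ = 0)).resolve_left (by simpa using hw)
      linear_combination (E - 1) / 2 * hv + v 0 / 2 * hbar'

end

end L2MBQC

namespace L2MBQC

open Polynomial ComplexConjugate

/-- Every state is reached from `|+⟩` by one block followed by a phase gate. -/
lemma exists_reachable_const {x y : ℂ} (h : ‖x‖ ^ 2 + ‖y‖ ^ 2 = 1) :
    ∃ (f : ℝ → ZMod 2 → ℂ) (α : ℝ) (κ : ℂ), Reachable 1 f ∧ ‖κ‖ = 1 ∧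
      ∀ τ : ℝ, phaseGate α (f τ) = κ • pair x y := by
  obtain ⟨α, β, h1, -⟩ := exists_angles_orthogonal (u := pair x y) (v := 0) (by simp)
  set g := xGate (-β) (phaseGate (-α) (pair x y)) with hg
  have hg0 : ‖g 0‖ = 1 := by
    have h2 := normSq_xGate (-β) (phaseGate (-α) (pair x y))
    rw [normSq_phaseGate, pair_zero, pair_one, h, ← hg, h1] at h2
    have h3 : ‖g 0‖ ^ 2 = 1 := by simpa using h2
    exact (pow_eq_one_iff_of_nonneg (norm_nonneg _) two_ne_zero).1 h3
  have hgv : g = g 0 • pair 1 0 := by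
    apply funext_zmod_two <;> simp [h1]
  have hback : pair x y = phaseGate α (xGate β g) := by
    rw [hg, xGate_neg_cancel, phaseGate_neg_cancel]
  -- These quarter turns take `|+⟩` to `|0⟩` up to a phase. The X rotation by `β` needed next merges
  -- into the same block.
  obtain ⟨μ, hμ, hplus⟩ : ∃ μ : ℂ, ‖μ‖ = 1 ∧
      xGate (Real.pi / 2) (phaseGate (Real.pi / 2) plusVec) = μ • pair 1 0 := by
    set v := xGate (Real.pi / 2) (phaseGate (Real.pi / 2) plusVec) with hv
    have e1 : Complex.exp (-(((Real.pi / 2 : ℝ) : ℂ) * Complex.I)) = -Complex.I := by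
      rw [Complex.exp_neg]
      push_cast
      rw [Complex.exp_pi_div_two_mul_I, Complex.inv_I]
    have hv1 : v 1 = 0 := by
      rw [hv, xGate_apply_one, phaseGate_apply_zero, phaseGate_apply_one, e1]
      simp only [plusVec]
      linear_combination (1 / (Real.sqrt 2 : ℂ) / 2) * Complex.I_sq
    refine ⟨v 0, ?_, ?_⟩
    · have h2 := normSq_xGate (Real.pi / 2) (phaseGate (Real.pi / 2) plusVec)
      have h4 : ‖plusVec 0‖ ^ 2 + ‖plusVec 1‖ ^ 2 = 1 := by
        simp only [plusVec, norm_div, norm_one, Complex.norm_real, Real.norm_eq_abs, div_pow,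
          sq_abs, Real.sq_sqrt (zero_le_two), one_pow]
        norm_num
      rw [normSq_phaseGate, h4, ← hv, hv1] at h2
      have h3 : ‖v 0‖ ^ 2 = 1 := by simpa using h2
      exact (pow_eq_one_iff_of_nonneg (norm_nonneg _) two_ne_zero).1 h3
    · apply funext_zmod_two <;> simp [hv1]
  have hg0' : g 0 ≠ 0 := fun h0 => by simp [h0] at hg0
  refine ⟨_, α, μ * (g 0)⁻¹, reachable_zero.step (Real.pi / 2) 0 (β + Real.pi / 2), ?_, ?_⟩
  · rw [norm_mul, norm_inv, hμ, hg0]; norm_num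
  · intro τ
    rw [zero_mul, add_zero, ← xGate_xGate, hplus, hback, hgv, xGate_smul, xGate_smul,
      phaseGate_smul, phaseGate_smul, smul_smul]
    congr 1
    simp [hg0']

/-- **Quantum signal processing**: a vector of polynomials of degree `d` that is normalized on the
unit circle is reached, up to a phase, by `d + 1` blocks and a phase gate. -/
theorem exists_reachable_polynomial (d : ℕ) : ∀ a b : ℂ[X], a.natDegree ≤ d → b.natDegree ≤ d →
    (∀ z : ℂ, ‖z‖ = 1 → ‖a.eval z‖ ^ 2 + ‖b.eval z‖ ^ 2 = 1) →
    ∃ (f : ℝ → ZMod 2 → ℂ) (α : ℝ) (κ : ℂ), Reachable (d + 1) f ∧ ‖κ‖ = 1 ∧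
      ∀ τ : ℝ, phaseGate α (f τ) =
        κ • pair (a.eval (Complex.exp (-(τ * Complex.I)))) (b.eval (Complex.exp (-(τ * Complex.I)))) := by
  induction d with
  | zero =>
    intro a b ha hb h
    obtain ⟨x, rfl⟩ := natDegree_eq_zero.1 (Nat.le_zero.1 ha)
    obtain ⟨y, rfl⟩ := natDegree_eq_zero.1 (Nat.le_zero.1 hb)
    simp only [eval_C] at h ⊢
    exact exists_reachable_const (h 1 (by simp))
  | succ d ih =>
    intro a b ha hb h
    -- Normalization as a polynomial identity. Its constant coefficient says that the lowest and
    -- highest coefficient vectors are orthogonal.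
    have hpoly : a * conjReflect (d + 1) a + b * conjReflect (d + 1) b = X ^ (d + 1) := by
      refine eq_of_eval_eq_on_unitCircle fun z hz => ?_
      have h1 : (‖a.eval z‖ : ℂ) ^ 2 + (‖b.eval z‖ : ℂ) ^ 2 = 1 := by exact_mod_cast h z hz
      rw [← Complex.mul_conj', ← Complex.mul_conj'] at h1
      simp only [eval_add, eval_mul, eval_conjReflect_of_norm_one ha hz,
        eval_conjReflect_of_norm_one hb hz, eval_pow, eval_X]
      linear_combination z ^ (d + 1) * h1
    have horth : a.coeff 0 * conj (a.coeff (d + 1)) + b.coeff 0 * conj (b.coeff (d + 1)) = 0 := by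
      have := congrArg (fun P => coeff P 0) hpoly
      simpa [mul_coeff_zero, coeff_zero_conjReflect, coeff_X_pow] using this
    -- Rotating the lowest coefficients onto the first axis and the highest onto the second makes
    -- `a'` lose its top degree and `b'` divisible by `X`. That factor `X` is a phase gate with
    -- angle `τ`, so one block splits off.
    obtain ⟨α, β, h1, h2⟩ := exists_angles_orthogonal
      (u := pair (a.coeff 0) (b.coeff 0)) (v := pair (a.coeff (d + 1)) (b.coeff (d + 1)))
      (by simpa using horth)
    set E := Complex.exp (-(((-β : ℝ) : ℂ) * Complex.I)) with hE
    set F := Complex.exp (-(((-α : ℝ) : ℂ) * Complex.I)) with hF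
    have hgate0 : ∀ x y : ℂ, xGate (-β) (phaseGate (-α) (pair x y)) 0 =
        (1 + E) / 2 * x + (1 - E) / 2 * F * y := by
      intro x y
      rw [xGate_apply_zero, phaseGate_apply_zero, phaseGate_apply_one, pair_zero, pair_one]
      ring
    have hgate1 : ∀ x y : ℂ, xGate (-β) (phaseGate (-α) (pair x y)) 1 =
        (1 - E) / 2 * x + (1 + E) / 2 * F * y := by
      intro x y
      rw [xGate_apply_one, phaseGate_apply_zero, phaseGate_apply_one, pair_zero, pair_one]
      ring
    set a' : ℂ[X] := C ((1 + E) / 2) * a + C ((1 - E) / 2 * F) * b with ha'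
    set b' : ℂ[X] := C ((1 - E) / 2) * a + C ((1 + E) / 2 * F) * b with hb'
    have hval : ∀ z, xGate (-β) (phaseGate (-α) (pair (a.eval z) (b.eval z))) =
        pair (a'.eval z) (b'.eval z) := by
      intro z
      apply funext_zmod_two
      · rw [hgate0, pair_zero, ha']; simp
      · rw [hgate1, pair_one, hb']; simp
    have hdega : a'.natDegree ≤ d + 1 := natDegree_add_le_of_degree_le
      ((natDegree_C_mul_le _ _).trans ha) ((natDegree_C_mul_le _ _).trans hb)
    have hdegb : b'.natDegree ≤ d + 1 := natDegree_add_le_of_degree_le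
      ((natDegree_C_mul_le _ _).trans ha) ((natDegree_C_mul_le _ _).trans hb)
    have htop : a'.coeff (d + 1) = 0 := by
      rw [hgate0] at h2
      rw [ha', coeff_add, coeff_C_mul, coeff_C_mul, h2]
    have hbot : b'.coeff 0 = 0 := by
      rw [hgate1] at h1
      rw [hb', coeff_add, coeff_C_mul, coeff_C_mul, h1]
    have hdega' : a'.natDegree ≤ d := by
      by_contra hlt
      have hd : a'.natDegree = d + 1 := by omega
      have h0 : a' = 0 := by rw [← leadingCoeff_eq_zero, leadingCoeff, hd, htop]
      rw [h0] at hlt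
      simp at hlt
    have hX : b' = X * b'.divX := by
      conv_lhs => rw [← X_mul_divX_add b', hbot]
      simp
    obtain ⟨f, α', κ, hf, hκ, hfv⟩ := ih a' b'.divX hdega'
      (by rw [natDegree_divX_eq_natDegree_tsub_one]; omega) (by
        intro z hz
        have h3 := normSq_xGate (-β) (phaseGate (-α) (pair (a.eval z) (b.eval z)))
        rw [normSq_phaseGate, hval, pair_zero, pair_one, pair_zero, pair_one, h z hz, hX,
          eval_mul, eval_X, norm_mul, hz, one_mul] at h3
        exact h3)
    refine ⟨_, α, κ, hf.step α' 1 β, hκ, fun τ => ?_⟩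
    set z := Complex.exp (-(τ * Complex.I)) with hz
    have h3 : phaseGate τ (pair (a'.eval z) (b'.divX.eval z)) = pair (a'.eval z) (b'.eval z) := by
      apply funext_zmod_two
      · rw [phaseGate_apply_zero, pair_zero, pair_zero]
      · rw [phaseGate_apply_one, pair_one, pair_one]
        conv_rhs => rw [hX, eval_mul, eval_X]
    have h4 : pair (a.eval z) (b.eval z) = phaseGate α (xGate β (pair (a'.eval z) (b'.eval z))) := by
      rw [← hval, xGate_neg_cancel, phaseGate_neg_cancel]
    rw [one_mul, add_comm, ← phaseGate_phaseGate, hfv, phaseGate_smul, xGate_smul, phaseGate_smul,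
      h3, h4]

/-- The states reached at the `p`-th roots of unity `exp (-iτ)`: `|+⟩` at `1`, and `|-⟩` at the
other ones. -/
theorem exists_blocks_mod {p : ℕ} (hp : Odd p) : ∃ c σ β : ℕ → ℝ, ∀ τ : ℝ, ∀ w : ZMod 2 → ℂ,
    w = hadGate (phaseGate (c (2 * p - 2) + σ (2 * p - 2) * τ)
      (blockState c σ β τ (2 * p - 2))) →
    Complex.exp (-(τ * Complex.I)) ^ p = 1 →
    (Complex.exp (-(τ * Complex.I)) = 1 → ‖w 0‖ = 1 ∧ w 1 = 0) ∧
    (Complex.exp (-(τ * Complex.I)) ≠ 1 → w 0 = 0 ∧ ‖w 1‖ = 1) := by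
  have hp0 : 0 < p := hp.pos
  by_cases hp1 : p = 1
  · subst hp1
    refine ⟨0, 0, 0, fun τ w hw hz => ⟨fun _ => ?_, fun h => absurd (by simpa using hz) h⟩⟩
    have h2 : plusVec = hadGate (pair 1 0) := by
      apply funext_zmod_two <;> simp [plusVec, hadGate_apply]
    have h1 : w = pair 1 0 := by
      rw [hw]
      simp [blockState, phaseGate_zero, h2, hadGate_hadGate]
    simp [h1]
  -- Oddness excludes `p = 2`: the `p + 1` blocks used below fit into `2 * p - 2` only from `p = 3`
  -- on.
  have hp3 : 3 ≤ p := by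
    rcases hp with ⟨k, rfl⟩
    omega
  have hpC : (p : ℂ) ≠ 0 := by exact_mod_cast hp0.ne'
  obtain ⟨d, rfl⟩ : ∃ d, p = d + 1 := ⟨p - 1, by omega⟩
  set A : ℂ[X] := C (((d + 1 : ℕ) : ℂ)⁻¹) * ∑ i ∈ Finset.range (d + 1), X ^ i with hA
  have hAeval : ∀ z, A.eval z = (((d + 1 : ℕ) : ℂ)⁻¹) * ∑ i ∈ Finset.range (d + 1), z ^ i := by
    intro z
    simp [hA, eval_finsetSum]
  have hAdeg : A.natDegree ≤ d := by
    refine (natDegree_C_mul_le _ _).trans (natDegree_sum_le_of_forall_le _ _ fun i hi => ?_)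
    rw [natDegree_X_pow]
    have := Finset.mem_range.1 hi
    omega
  have hAnorm : ∀ z : ℂ, ‖z‖ = 1 → ‖A.eval z‖ ≤ 1 := by
    intro z hz
    rw [hAeval, norm_mul, norm_inv, Complex.norm_natCast]
    have h1 : ‖∑ i ∈ Finset.range (d + 1), z ^ i‖ ≤ (d + 1 : ℕ) := by
      refine (norm_sum_le _ _).trans ?_
      simp [norm_pow, hz]
    rw [inv_mul_le_iff₀ (by positivity), mul_one]
    exact h1
  have hcr : ∀ z : ℂ, ‖z‖ = 1 → (X ^ d - A * conjReflect d A).eval z =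
      ((1 - ‖A.eval z‖ ^ 2 : ℝ) : ℂ) * z ^ d := by
    intro z hz
    rw [eval_sub, eval_pow, eval_X, eval_mul, eval_conjReflect_of_norm_one hAdeg hz]
    have h1 := Complex.mul_conj' (A.eval z)
    push_cast
    linear_combination -z ^ d * h1
  obtain ⟨B, hBdeg, hB⟩ := fejerRiesz d (X ^ d - A * conjReflect d A) (by
      refine (natDegree_sub_le _ _).trans (max_le ?_ ?_)
      · rw [natDegree_X_pow]; omega
      · refine natDegree_mul_le.trans ?_
        have h1 : (conjReflect d A).natDegree ≤ d := by
          refine natDegree_reflect_le.trans (max_le le_rfl (natDegree_map_le.trans hAdeg))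
        omega)
    (fun z hz => ⟨1 - ‖A.eval z‖ ^ 2, by
      have := hAnorm z hz
      nlinarith [norm_nonneg (A.eval z)], hcr z hz⟩)
  have hAB : ∀ z : ℂ, ‖z‖ = 1 → ‖A.eval z‖ ^ 2 + ‖B.eval z‖ ^ 2 = 1 := by
    intro z hz
    have h1 := hB z hz
    rw [hcr z hz] at h1
    have h2 := mul_right_cancel₀ (pow_ne_zero d (ne_zero_of_norm_one hz)) h1
    have h3 : (1 - ‖A.eval z‖ ^ 2 : ℝ) = ‖B.eval z‖ ^ 2 := by exact_mod_cast h2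
    linarith
  -- The chain ends with the Hadamard gate of a half block, so the state to reach before it is `H
  -- (A, B)`.
  set s : ℂ := (Real.sqrt 2 : ℂ)⁻¹ with hs
  set a : ℂ[X] := C s * (A + B) with ha
  set b : ℂ[X] := C s * (A - B) with hb
  have hv : ∀ z, pair (a.eval z) (b.eval z) = hadGate (pair (A.eval z) (B.eval z)) := by
    intro z
    apply funext_zmod_two <;>
      simp only [hadGate_apply, pair_zero, pair_one, sgn_zero, sgn_one, ha, hb, eval_mul, eval_C,
        eval_add, eval_sub, hs] <;> ring
  obtain ⟨f, α, κ, hf, hκ, hfv⟩ := exists_reachable_polynomial d a b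
    ((natDegree_C_mul_le _ _).trans (natDegree_add_le_of_degree_le hAdeg hBdeg))
    ((natDegree_C_mul_le _ _).trans ((natDegree_sub_le _ _).trans (max_le hAdeg hBdeg))) (by
      intro z hz
      have h1 := normSq_hadGate (pair (A.eval z) (B.eval z))
      rw [← hv] at h1
      simp only [pair_zero, pair_one] at h1
      rw [h1, hAB z hz])
  -- The leftover phase gate `α` becomes a block with no signal and no X rotation.
  obtain ⟨c, σ, β, h0, hblock⟩ := (hf.step α 0 0).exists_forall_le
  refine ⟨c, σ, β, fun τ w hw hz => ?_⟩
  obtain ⟨h1, h2, -⟩ := h0 (2 * (d + 1) - 2) (by omega)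
  rw [hblock τ _ (by omega), h1, h2, zero_mul, add_zero, add_zero, phaseGate_zero,
    xGate_zero, hfv, hadGate_smul, hv, hadGate_hadGate] at hw
  set z := Complex.exp (-(τ * Complex.I)) with hzdef
  have hzn : ‖z‖ = 1 := norm_exp_neg_mul_I τ
  have hw0 : w 0 = κ * A.eval z := by rw [hw]; simp
  have hw1 : w 1 = κ * B.eval z := by rw [hw]; simp
  have hABz := hAB z hzn
  constructor
  · intro hz1
    have hA1 : A.eval z = 1 := by
      rw [hAeval, hz1]
      simp only [one_pow, Finset.sum_const, Finset.card_range, nsmul_eq_mul, mul_one]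
      exact inv_mul_cancel₀ hpC
    have hB0 : B.eval z = 0 := by
      rw [hA1] at hABz
      simpa using hABz
    rw [hw0, hw1, hA1, hB0]
    simp [hκ]
  · intro hz1
    have hA0 : A.eval z = 0 := by
      rw [hAeval]
      have h3 := geom_sum_mul z (d + 1)
      rw [hz, sub_self] at h3
      rw [(mul_eq_zero.1 h3).resolve_right (sub_ne_zero.2 hz1), mul_zero]
    have hB1 : ‖B.eval z‖ = 1 := by
      rw [hA0] at hABz
      exact (pow_eq_one_iff_of_nonneg (norm_nonneg _) two_ne_zero).1 (by simpa using hABz)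
    rw [hw0, hw1, hA0, norm_mul, hκ, hB1]
    simp

end L2MBQC

namespace L2MBQC

open ComplexConjugate

/-! ### Amplitudes and preparation of the cluster state -/

lemma applyOne_hadamard {N : ℕ} (k : Fin N) (ψ : Ket N) (a : Bits N) :
    applyOne hadamard k ψ a = (ψ (Function.update a k 0) +
      sgn (a k) * ψ (Function.update a k 1)) * (1 / (Real.sqrt 2 : ℂ)) := by
  simp only [applyOne, sum_zmod_two, hadamard, Matrix.of_apply, mul_zero, mul_one, sgn_zero]
  ring

lemma foldl_hadamard_ketZero {N : ℕ} (l : List (Fin N)) (hl : l.Nodup) (a : Bits N) :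
    l.foldl (fun ψ k => applyOne hadamard k ψ) (ketZero N) a =
      if ∀ k, k ∉ l → a k = 0 then (1 / (Real.sqrt 2 : ℂ)) ^ l.length else 0 := by
  induction l using List.reverseRecOn generalizing a with
  | nil =>
    have h : a = 0 ↔ ∀ k, a k = 0 := funext_iff
    simp [ketZero, h]
  | append_singleton l k ih =>
    have hl' : l.Nodup := (List.nodup_append.1 hl).1
    have hk : k ∉ l := fun h => (List.nodup_append.1 hl).2.2 k h k (by simp) rfl
    have h1 : ¬ ∀ i, i ∉ l → Function.update a k 1 i = 0 := fun h => by
      simpa using h k hk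
    have h0 : (∀ i, i ∉ l → Function.update a k 0 i = 0) ↔ ∀ i, i ∉ l ++ [k] → a i = 0 := by
      refine forall_congr' fun i => ?_
      by_cases hik : i = k
      · subst hik; simp
      · simp [hik]
    rw [List.foldl_append, List.foldl_cons, List.foldl_nil, applyOne_hadamard, ih hl', ih hl',
      if_neg h1, mul_zero, add_zero, List.length_append, List.length_singleton, pow_succ]
    simp only [h0]
    split_ifs <;> simp

lemma ketPlus_apply {N : ℕ} (a : Bits N) : ketPlus N a = (1 / (Real.sqrt 2 : ℂ)) ^ N := by
  rw [ketPlus, foldl_hadamard_ketZero _ (List.nodup_finRange N), if_pos, List.length_finRange]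
  intro k hk
  exact absurd (List.mem_finRange k) hk

lemma foldl_mul_apply {ι κ : Type*} (g : ι → κ → ℂ) (l : List ι) (ψ : κ → ℂ) (a : κ) :
    l.foldl (fun φ k a => g k a * φ a) ψ a = (l.map fun k => g k a).prod * ψ a := by
  induction l generalizing ψ with
  | nil => simp
  | cons k l ih => simp [ih]; ring

/-- The amplitude factor of the controlled-`Z` gate on the qubits `k`, `k + 1` of the chain. -/
noncomputable def czFactor {N : ℕ} (a : Bits N) (k : Fin N) : ℂ :=
  if h : k.val + 1 < N then sgn (a k * a ⟨k.val + 1, h⟩) else 1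

lemma norm_czFactor {N : ℕ} (a : Bits N) (k : Fin N) : ‖czFactor a k‖ = 1 := by
  unfold czFactor
  split_ifs
  · exact norm_sgn _
  · simp

lemma clusterState_apply {N : ℕ} (a : Bits N) :
    clusterState N a = (∏ k, czFactor a k) * (1 / (Real.sqrt 2 : ℂ)) ^ N := by
  have h : (fun (ψ : Ket N) (k : Fin N) =>
      if h : k.val + 1 < N then applyCZ k ⟨k.val + 1, h⟩ ψ else ψ) =
      fun ψ k a => czFactor a k * ψ a := by
    funext ψ k a
    unfold czFactor
    split_ifs
    · rfl
    · simp
  rw [clusterState, h, foldl_mul_apply (fun k a => czFactor a k), ketPlus_apply, Fin.prod_univ_def]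

lemma norm_one_div_sqrt_two_pow_sq (N : ℕ) :
    ‖(1 / (Real.sqrt 2 : ℂ)) ^ N‖ ^ 2 = 1 / 2 ^ N := by
  rw [norm_pow, ← pow_mul, mul_comm, pow_mul, norm_div, norm_one, Complex.norm_real,
    Real.norm_eq_abs, div_pow, sq_abs, Real.sq_sqrt zero_le_two, one_pow, div_pow, one_pow]

lemma clusterState_norm (N : ℕ) : ∑ a, ‖clusterState N a‖ ^ 2 = 1 := by
  have h : ∀ a : Bits N, ‖clusterState N a‖ ^ 2 = 1 / 2 ^ N := by
    intro a
    rw [clusterState_apply, norm_mul, norm_prod, Finset.prod_congr rfl fun k _ => norm_czFactor a k,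
      Finset.prod_const_one, one_mul, norm_one_div_sqrt_two_pow_sq]
  simp only [h, Finset.sum_const, Finset.card_univ, Fintype.card_fun, ZMod.card, Fintype.card_fin,
    nsmul_eq_mul]
  push_cast
  field_simp

/-- The controlled-`Z` gates of the chain on the pairs `k`, `k + 1` with `k % 2 = e`. -/
def czLayer (N e : ℕ) : List (Gate N) :=
  (List.finRange N).filterMap fun k =>
    if h : k.val + 1 < N ∧ k.val % 2 = e then some (Gate.cz k ⟨k.val + 1, h.1⟩ rfl) else none

lemma czLayer_pairwise (N e : ℕ) :
    (czLayer N e).Pairwise fun g h => Disjoint g.support h.support := by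
  rw [czLayer, List.pairwise_filterMap]
  refine (List.nodup_finRange N).imp ?_
  intro i j hij g hg g' hg'
  split_ifs at hg hg' with h1 h2
  obtain rfl := Option.some.inj hg
  obtain rfl := Option.some.inj hg'
  have hij' : i.val ≠ j.val := fun h => hij (Fin.ext h)
  simp only [Gate.support, Finset.disjoint_insert_left, Finset.disjoint_singleton_left,
    Finset.mem_insert, Finset.mem_singleton, Fin.ext_iff]
  omega

lemma foldl_czLayer {N : ℕ} (e : ℕ) (ψ : Ket N) (a : Bits N) :
    (czLayer N e).foldl (fun φ g => g.apply φ) ψ a =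
      (∏ k : Fin N, if k.val % 2 = e then czFactor a k else 1) * ψ a := by
  rw [czLayer, List.foldl_filterMap, Fin.prod_univ_def,
    ← foldl_mul_apply (fun k a => if k.val % 2 = e then czFactor a k else 1)]
  refine congrFun (congrArg (fun F => List.foldl F ψ (List.finRange N)) ?_) a
  funext φ k a
  unfold czFactor
  by_cases h1 : k.val % 2 = e <;> by_cases h2 : k.val + 1 < N <;>
    simp [h1, h2, Gate.apply, applyCZ]

/-- Controlled-`Z` gates are diagonal and commute, and the even and the odd edges of the chain each
form a matching. -/
lemma clusterState_preparedInDepth (N : ℕ) : PreparedInDepth (clusterState N) 3 := by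
  refine ⟨[(List.finRange N).map Gate.had, czLayer N 0, czLayer N 1], rfl, ?_, ?_⟩
  · intro l hl
    simp only [List.mem_cons, List.not_mem_nil, or_false] at hl
    rcases hl with rfl | rfl | rfl
    · rw [List.pairwise_map]
      refine (List.nodup_finRange N).imp ?_
      intro i j hij
      simpa [Gate.support] using hij
    · exact czLayer_pairwise N 0
    · exact czLayer_pairwise N 1
  · funext a
    simp only [List.foldl_cons, List.foldl_nil]
    rw [foldl_czLayer, foldl_czLayer, List.foldl_map, clusterState_apply, ← mul_assoc,
      ← Finset.prod_mul_distrib]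
    congr 1
    · refine Finset.prod_congr rfl fun k _ => ?_
      rcases Nat.mod_two_eq_zero_or_one k.val with h | h <;> simp [h]
    · exact ketPlus_apply a

/-! ### Measurements in the equatorial plane -/

noncomputable section

/-- The observable `cos α X + sin α Y`. -/
def xyObs (α : ℝ) : Op := Matrix.of fun a b =>
  if a = b then 0 else if a = 0 then Complex.exp (-(α * Complex.I))
    else Complex.exp (α * Complex.I)

lemma conj_exp_mul_I (α : ℝ) :
    conj (Complex.exp (α * Complex.I)) = Complex.exp (-(α * Complex.I)) := by
  rw [← Complex.exp_conj]
  simp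

lemma conj_exp_neg_mul_I (α : ℝ) :
    conj (Complex.exp (-(α * Complex.I))) = Complex.exp (α * Complex.I) := by
  rw [← Complex.exp_conj]
  simp

lemma exp_neg_mul_exp (α : ℝ) :
    Complex.exp (-(α * Complex.I)) * Complex.exp (α * Complex.I) = 1 := by
  rw [← Complex.exp_add, neg_add_cancel, Complex.exp_zero]

lemma xyObs_isHermitian (α : ℝ) : (xyObs α).IsHermitian := by
  ext a b
  rcases zmod_two_cases a with rfl | rfl <;> rcases zmod_two_cases b with rfl | rfl <;>
    simp [xyObs, conj_exp_mul_I, conj_exp_neg_mul_I]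

lemma xyObs_mul_self (α : ℝ) : xyObs α * xyObs α = 1 := by
  have h := exp_neg_mul_exp α
  ext a b
  rw [Matrix.mul_apply, sum_zmod_two]
  rcases zmod_two_cases a with rfl | rfl <;> rcases zmod_two_cases b with rfl | rfl <;>
    simp [xyObs, h, mul_comm (Complex.exp (α * Complex.I))]

lemma xyObs_trace (α : ℝ) : (xyObs α).trace = 0 := by
  simp [Matrix.trace, xyObs]

/-- The eigenvector of `xyObs α` for the eigenvalue `(-1)^m`. -/
def xyVec (α : ℝ) (m : ZMod 2) : ZMod 2 → ℂ := fun a =>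
  (if a = 0 then 1 else sgn m * Complex.exp (α * Complex.I)) / (Real.sqrt 2 : ℂ)

lemma eigenproj_xyObs (α : ℝ) (m a b : ZMod 2) :
    Protocol.eigenproj (xyObs α) m a b = xyVec α m a * conj (xyVec α m b) := by
  have h := exp_neg_mul_exp α
  have h2 := sqrt_two_mul_self
  have h3 : (1 / 2 : ℂ) = 1 / (Real.sqrt 2 : ℂ) * (1 / (Real.sqrt 2 : ℂ)) := by
    rw [← h2]; field_simp
  have hs : sgn m * sgn m = 1 := by
    rcases zmod_two_cases m with rfl | rfl <;> simp [sgn_zero, sgn_one]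
  have hc : conj (sgn m) = sgn m := by
    rcases zmod_two_cases m with rfl | rfl <;> simp [sgn_zero, sgn_one]
  rcases zmod_two_cases a with rfl | rfl <;> rcases zmod_two_cases b with rfl | rfl <;>
    simp only [Protocol.eigenproj, Matrix.smul_apply, Matrix.add_apply, h3, smul_eq_mul, xyVec,
      xyObs, Matrix.of_apply, if_true, one_ne_zero, zero_ne_one, if_false, map_div₀, map_mul,
      Complex.conj_ofReal, conj_exp_mul_I, hc, Matrix.one_apply_eq, Matrix.one_apply_ne, ne_eq,
      not_false_eq_true, map_one, mul_zero, add_zero, zero_add]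
  · ring
  · ring
  · ring
  · linear_combination (-1 / (Real.sqrt 2 : ℂ) ^ 2) * (hs + sgn m ^ 2 * h)

lemma sum_norm_xyVec_sq (α : ℝ) (m : ZMod 2) : ∑ a, ‖xyVec α m a‖ ^ 2 = 1 := by
  rw [sum_zmod_two]
  simp only [xyVec, if_true, one_ne_zero, if_false, norm_div, norm_mul, norm_sgn, norm_one,
    Complex.norm_exp_ofReal_mul_I, Complex.norm_real, Real.norm_eq_abs, div_pow, sq_abs,
    Real.sq_sqrt zero_le_two]
  norm_num

/-- The probability of a string of outcomes under rank-one product measurements is the squared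
modulus of an overlap. -/
lemma sum_norm_sq_product_projection {N : ℕ} (v : Fin N → ZMod 2 → ℂ)
    (hv : ∀ k, ∑ a, ‖v k a‖ ^ 2 = 1) (ψ : Ket N) :
    ∑ a : Bits N, ‖∑ b : Bits N, (∏ k, v k (a k) * conj (v k (b k))) * ψ b‖ ^ 2 =
      ‖∑ b : Bits N, (∏ k, conj (v k (b k))) * ψ b‖ ^ 2 := by
  have h1 : ∀ a : Bits N, ‖∑ b : Bits N, (∏ k, v k (a k) * conj (v k (b k))) * ψ b‖ ^ 2 =
      (∏ k, ‖v k (a k)‖ ^ 2) * ‖∑ b : Bits N, (∏ k, conj (v k (b k))) * ψ b‖ ^ 2 := by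
    intro a
    simp only [Finset.prod_mul_distrib, mul_assoc]
    rw [← Finset.mul_sum, norm_mul, norm_prod, mul_pow, Finset.prod_pow]
  simp only [h1]
  rw [← Finset.sum_mul]
  have h2 : ∑ a : Bits N, ∏ k, ‖v k (a k)‖ ^ 2 = 1 := by
    have := (Finset.prod_univ_sum (fun _ : Fin N => (Finset.univ : Finset (ZMod 2)))
      (fun k a => ‖v k a‖ ^ 2)).symm
    rw [Fintype.piFinset_univ] at this
    rw [this]
    simp [hv]
  rw [h2, one_mul]

/-- Contraction of a chain with nearest-neighbour couplings, from left to right. -/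
def chainVec (g : ℕ → ZMod 2 → ℂ) : ℕ → ZMod 2 → ℂ
  | 0 => g 0
  | k + 1 => fun c => g (k + 1) c * ∑ b, sgn (b * c) * chainVec g k b

/-- The boundary function `F` is arbitrary so that the coupling to an appended qubit can serve as
the boundary function of the shorter chain. -/
lemma sum_chain (g : ℕ → ZMod 2 → ℂ) (M : ℕ) (F : ZMod 2 → ℂ) :
    ∑ b : Bits (M + 1), (∏ k : Fin (M + 1), g k (b k)) *
      (∏ k : Fin M, sgn (b k.castSucc * b k.succ)) * F (b (Fin.last M)) =
      ∑ c, F c * chainVec g M c := by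
  induction M generalizing F with
  | zero =>
    rw [← (Equiv.funUnique (Fin 1) (ZMod 2)).symm.sum_comp]
    refine Finset.sum_congr rfl fun c _ => ?_
    simp [chainVec, mul_comm]
  | succ M ih =>
    rw [← (Fin.snocEquiv (fun _ : Fin (M + 2) => ZMod 2)).sum_comp, Fintype.sum_prod_type]
    refine Finset.sum_congr rfl fun c _ => ?_
    have h := ih (fun b => sgn (b * c))
    simp only [chainVec]
    rw [← h, Finset.mul_sum, Finset.mul_sum]
    refine Finset.sum_congr rfl fun b _ => ?_
    have hA : ∏ k : Fin (M + 2), g k (Fin.snoc (α := fun _ => ZMod 2) b c k) =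
        (∏ k : Fin (M + 1), g k (b k)) * g (M + 1) c := by
      rw [Fin.prod_univ_castSucc]
      simp
    have hB : ∏ k : Fin (M + 1), sgn (Fin.snoc (α := fun _ => ZMod 2) b c k.castSucc *
        Fin.snoc (α := fun _ => ZMod 2) b c k.succ) =
        (∏ k : Fin M, sgn (b k.castSucc * b k.succ)) * sgn (b (Fin.last M) * c) := by
      rw [Fin.prod_univ_castSucc]
      simp only [Fin.succ_castSucc, Fin.snoc_castSucc, Fin.succ_last, Fin.snoc_last]
    simp only [Fin.snocEquiv, Equiv.coe_fn_mk, hA, hB, Fin.snoc_last]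
    ring

lemma prod_czFactor {M : ℕ} (b : Bits (M + 1)) :
    ∏ k, czFactor b k = ∏ k : Fin M, sgn (b k.castSucc * b k.succ) := by
  rw [Fin.prod_univ_castSucc]
  have h1 : czFactor b (Fin.last M) = 1 := by simp [czFactor]
  rw [h1, mul_one]
  refine Finset.prod_congr rfl fun k _ => ?_
  have h2 : (k.castSucc : Fin (M + 1)).val + 1 < M + 1 := by simp
  rw [czFactor, dif_pos h2]
  rfl

end

end L2MBQC

namespace L2MBQC

open ComplexConjugate

noncomputable section

/-! ### Byproduct operators -/

/-- The state teleported along the chain when qubit `k` is measured at the angle `φ k`, with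
outcome `m k`. -/
def measuredState (φ : ℕ → ℝ) (m : ℕ → ZMod 2) : ℕ → ZMod 2 → ℂ
  | 0 => plusVec
  | k + 1 => hadGate fun b => sgn (m k * b) * phaseGate (φ k) (measuredState φ m k) b

/-- The state teleported along the chain when all outcomes are `0`. -/
def idealState (φ : ℕ → ℝ) : ℕ → ZMod 2 → ℂ
  | 0 => plusVec
  | k + 1 => hadGate (phaseGate (φ k) (idealState φ k))

/-- The angle `(-1)^s θ`. -/
def signedAngle (s : ZMod 2) (θ : ℝ) : ℝ := if s = 0 then θ else -θ

lemma signedAngle_angle_zero (s : ZMod 2) : signedAngle s 0 = 0 := by simp [signedAngle]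

lemma signedAngle_zero (θ : ℝ) : signedAngle 0 θ = θ := by simp [signedAngle]

lemma signedAngle_add_one (s : ZMod 2) (θ : ℝ) : signedAngle (s + 1) θ = -signedAngle s θ := by
  have h : (1 : ZMod 2) + 1 = 0 := by decide
  rcases zmod_two_cases s with rfl | rfl <;> simp [signedAngle, h]

/-- The exponent of the Pauli `X` byproduct before qubit `k`. -/
def xByproduct (m : ℕ → ZMod 2) (k : ℕ) : ZMod 2 :=
  ∑ i ∈ Finset.range k, if i % 2 ≠ k % 2 then m i else 0

/-- The exponent of the Pauli `Z` byproduct before qubit `k`. -/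
def zByproduct (m : ℕ → ZMod 2) (k : ℕ) : ZMod 2 :=
  ∑ i ∈ Finset.range k, if i % 2 = k % 2 then m i else 0

lemma xByproduct_succ (m : ℕ → ZMod 2) (k : ℕ) :
    xByproduct m (k + 1) = zByproduct m k + m k := by
  rw [xByproduct, zByproduct, Finset.sum_range_succ, if_pos (by omega)]
  congr 1
  refine Finset.sum_congr rfl fun i _ => if_congr (by omega) rfl rfl

lemma zByproduct_succ (m : ℕ → ZMod 2) (k : ℕ) : zByproduct m (k + 1) = xByproduct m k := by
  rw [xByproduct, zByproduct, Finset.sum_range_succ, if_neg (by omega), add_zero]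
  refine Finset.sum_congr rfl fun i _ => if_congr (by omega) rfl rfl

/-- One step of teleportation commutes with the Pauli byproducts. -/
lemma hadGate_byproduct (u : ZMod 2 → ℂ) (x z m : ZMod 2) (s : ZMod 2) (θ : ℝ) :
    ∃ κ : ℂ, ‖κ‖ = 1 ∧ ∀ c,
      hadGate (fun b => sgn (m * b) * phaseGate (signedAngle (s + x) θ)
        (fun b => sgn (z * b) * u (b + x)) b) c =
      κ * (sgn (x * c) * hadGate (phaseGate (signedAngle s θ) u) (c + (z + m))) := by
  have h11 : (1 : ZMod 2) + 1 = 0 := by decide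
  rcases zmod_two_cases x with rfl | rfl
  · refine ⟨1, by simp, fun c => ?_⟩
    rcases zmod_two_cases m with rfl | rfl <;> rcases zmod_two_cases z with rfl | rfl <;>
      rcases zmod_two_cases c with rfl | rfl <;>
      simp [hadGate_apply, phaseGate_apply_one, phaseGate_apply_zero, sgn_zero, sgn_one, h11]
  · have hinv := exp_neg_mul_exp (signedAngle s θ)
    -- Moving `X` past the phase gate reverses its angle at the cost of `exp (it)`; reordering `X`
    -- and `Z` after the Hadamard gate costs the sign.
    refine ⟨sgn (z + m) * Complex.exp (signedAngle s θ * Complex.I), ?_, fun c => ?_⟩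
    · rw [norm_mul, norm_sgn, Complex.norm_exp_ofReal_mul_I, one_mul]
    · rw [signedAngle_add_one]
      generalize signedAngle s θ = t at *
      have hneg : Complex.exp (-(((-t : ℝ) : ℂ) * Complex.I)) = Complex.exp (t * Complex.I) := by
        push_cast
        ring_nf
      rcases zmod_two_cases m with rfl | rfl <;> rcases zmod_two_cases z with rfl | rfl <;>
        rcases zmod_two_cases c with rfl | rfl <;>
        simp only [hadGate_apply, phaseGate_apply_one, phaseGate_apply_zero, sgn_zero, sgn_one,
          h11, hneg, zero_add, add_zero, mul_zero, mul_one, one_mul, zero_mul] <;>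
        first
        | linear_combination (u 1 / (Real.sqrt 2 : ℂ)) * hinv
        | linear_combination (-u 1 / (Real.sqrt 2 : ℂ)) * hinv

/-- The angle at qubit `k` already contains the X byproduct, which cancels when commuted past the
phase gate. Only Pauli operators and a global phase remain. -/
lemma measuredState_eq (θ : ℕ → ℝ) (y m : ℕ → ZMod 2) (φ : ℕ → ℝ) (N : ℕ)
    (hφ : ∀ k < N, φ k = signedAngle (y k + xByproduct m k) (θ k)) :
    ∀ k ≤ N, ∃ κ : ℂ, ‖κ‖ = 1 ∧ ∀ c, measuredState φ m k c =
      κ * (sgn (zByproduct m k * c) *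
        idealState (fun i => signedAngle (y i) (θ i)) k (c + xByproduct m k)) := by
  intro k hk
  induction k with
  | zero => exact ⟨1, by simp, fun c => by simp [measuredState, idealState, zByproduct, sgn_zero,
      plusVec]⟩
  | succ k ih =>
    obtain ⟨κ, hκ, h⟩ := ih (by omega)
    obtain ⟨κ', hκ', h'⟩ := hadGate_byproduct (idealState (fun i => signedAngle (y i) (θ i)) k)
      (xByproduct m k) (zByproduct m k) (m k) (y k) (θ k)
    refine ⟨κ * κ', by rw [norm_mul, hκ, hκ', one_mul], fun c => ?_⟩
    have hfun : measuredState φ m k = κ • fun b => sgn (zByproduct m k * b) *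
        idealState (fun i => signedAngle (y i) (θ i)) k (b + xByproduct m k) := by
      funext c
      rw [h c, Pi.smul_apply, smul_eq_mul]
    have hstep : (fun b => sgn (m k * b) * phaseGate (φ k) (measuredState φ m k) b) =
        κ • fun b => sgn (m k * b) * phaseGate (signedAngle (y k + xByproduct m k) (θ k))
          (fun b => sgn (zByproduct m k * b) *
            idealState (fun i => signedAngle (y i) (θ i)) k (b + xByproduct m k)) b := by
      rw [hfun, phaseGate_smul, hφ k (by omega)]
      funext b
      simp only [Pi.smul_apply, smul_eq_mul]
      ring
    rw [measuredState, hstep, hadGate_smul, Pi.smul_apply, smul_eq_mul, h' c, idealState,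
      zByproduct_succ, xByproduct_succ]
    ring

/-- The `1 / √2` of each equatorial vector normalizes `|+⟩` at qubit `0`, and at later qubits the
Hadamard gate made by the coupling to the previous one. -/
lemma chainVec_eq_measuredState (φ : ℕ → ℝ) (m : ℕ → ZMod 2) (k : ℕ) :
    chainVec (fun k b => conj (xyVec (φ k) (m k) b)) k =
      fun b => sgn (m k * b) * phaseGate (φ k) (measuredState φ m k) b := by
  have hg : ∀ k b (v : ZMod 2 → ℂ), conj (xyVec (φ k) (m k) b) * v b =
      sgn (m k * b) * phaseGate (φ k) v b * (1 / (Real.sqrt 2 : ℂ)) := by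
    intro k b v
    have hc : conj (sgn (m k)) = sgn (m k) := by
      rcases zmod_two_cases (m k) with h | h <;> simp [h, sgn_zero, sgn_one]
    rcases zmod_two_cases b with rfl | rfl
    · simp only [xyVec, if_true, mul_zero, sgn_zero, phaseGate_apply_zero, map_div₀, map_one,
        Complex.conj_ofReal]
      ring
    · simp only [xyVec, one_ne_zero, if_false, mul_one, phaseGate_apply_one, map_div₀, map_mul,
        Complex.conj_ofReal, hc, conj_exp_mul_I]
      ring
  induction k with
  | zero =>
    funext b
    have := hg 0 b fun _ => 1
    rw [mul_one] at this
    simp only [chainVec, this, measuredState, phaseGate, plusVec]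
    ring
  | succ k ih =>
    funext c
    simp only [chainVec, ih]
    rw [hg (k + 1) c fun c => ∑ b, sgn (b * c) *
      (sgn (m k * b) * phaseGate (φ k) (measuredState φ m k) b)]
    have h2 : measuredState φ m (k + 1) = (1 / (Real.sqrt 2 : ℂ)) • fun c => ∑ b, sgn (b * c) *
        (sgn (m k * b) * phaseGate (φ k) (measuredState φ m k) b) := by
      funext c
      rw [measuredState, hadGate_apply, Pi.smul_apply, smul_eq_mul, sum_zmod_two]
      simp only [zero_mul, one_mul, sgn_zero]
      ring
    rw [h2, phaseGate_smul, Pi.smul_apply, smul_eq_mul]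
    ring

/-- The overlap of the cluster state with a product of equatorial states. -/
lemma norm_overlap_clusterState {N : ℕ} (hN : 0 < N) (φ : ℕ → ℝ) (m : ℕ → ZMod 2) :
    ‖∑ b : Bits N, (∏ k : Fin N, conj (xyVec (φ k) (m k) (b k))) * clusterState N b‖ ^ 2 =
      2 / 2 ^ N * ‖measuredState φ m N 0‖ ^ 2 := by
  obtain ⟨M, rfl⟩ : ∃ M, N = M + 1 := ⟨N - 1, by omega⟩
  have h := sum_chain (fun k b => conj (xyVec (φ k) (m k) b)) M fun _ => 1
  simp only [mul_one, one_mul] at h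
  -- The last qubit has no successor: summing over its index is `√2` times the amplitude at `0`
  -- after one more Hadamard gate.
  have h1 : ∑ b : Bits (M + 1), (∏ k : Fin (M + 1), conj (xyVec (φ k) (m k) (b k))) *
      clusterState (M + 1) b = measuredState φ m (M + 1) 0 * (Real.sqrt 2 : ℂ) *
        (1 / (Real.sqrt 2 : ℂ)) ^ (M + 1) := by
    simp only [clusterState_apply, prod_czFactor, ← mul_assoc]
    rw [← Finset.sum_mul, h, chainVec_eq_measuredState, measuredState, hadGate_apply, sum_zmod_two,
      sgn_zero, one_mul, div_mul_cancel₀ _ sqrt_two_ne_zero]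
  rw [h1, norm_mul, norm_mul, mul_pow, mul_pow, norm_one_div_sqrt_two_pow_sq, Complex.norm_real,
    Real.norm_eq_abs, sq_abs, Real.sq_sqrt zero_le_two]
  ring

/-! ### Protocols on the cluster chain -/

/-- The protocol that measures qubit `k` of the cluster chain at the angle `± θ k`, where the sign
is the parity `pre k` of the input, corrected at the active qubits by the `X` byproduct. -/
def chainProtocol {n : ℕ} (N : ℕ) (θ : ℕ → ℝ) (act : ℕ → Prop) [DecidablePred act]
    (pre : ℕ → Bits n) : Protocol n N where
  state := clusterState N
  state_norm := clusterState_norm N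
  obs k s := xyObs (signedAngle s (θ k))
  obs_hermitian _ _ := xyObs_isHermitian _
  obs_sq _ _ := xyObs_mul_self _
  obs_trace _ _ := xyObs_trace _
  pre := Matrix.of fun k i => pre k i
  adapt := Matrix.of fun j k => if act j ∧ k < j ∧ k.val % 2 ≠ j.val % 2 then 1 else 0
  causal := ⟨1, fun j k h => by
    by_contra h'
    exact h (if_neg fun hc => h' hc.2.1)⟩
  outMask k := if k.val % 2 ≠ N % 2 then 1 else 0
  outConst := 0

variable {n N : ℕ} {θ : ℕ → ℝ} {act : ℕ → Prop} [DecidablePred act] {pre : ℕ → Bits n}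

/-- The extension by zero of a string of outcomes. -/
def extendBits (m : Bits N) (k : ℕ) : ZMod 2 := if h : k < N then m ⟨k, h⟩ else 0

lemma extendBits_val (m : Bits N) (k : Fin N) : extendBits m k = m k := by simp [extendBits]

lemma chainProtocol_output (m : Bits N) :
    (chainProtocol N θ act pre).output m = xByproduct (extendBits m) N := by
  simp only [Protocol.output, chainProtocol, dotProduct, add_zero, xByproduct,
    Finset.sum_range, extendBits_val, ite_mul, one_mul, zero_mul]

lemma chainProtocol_adapt_mulVec (m : Bits N) (j : Fin N) :
    (chainProtocol N θ act pre).adapt.mulVec m j =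
      if act j then xByproduct (extendBits m) j else 0 := by
  have h : ∑ k : Fin N, (if k < j ∧ k.val % 2 ≠ j.val % 2 then m k else 0) =
      xByproduct (extendBits m) j := by
    have h1 : ∑ k : Fin N, (if k < j ∧ k.val % 2 ≠ j.val % 2 then m k else 0) =
        ∑ k ∈ Finset.range N, if k < j.val ∧ k % 2 ≠ j.val % 2 then extendBits m k else 0 := by
      rw [Finset.sum_range]
      refine Finset.sum_congr rfl fun k _ => ?_
      rw [extendBits_val]
      rfl
    rw [h1, xByproduct, ← Finset.sum_filter, ← Finset.sum_filter]
    refine Finset.sum_congr ?_ fun _ _ => rfl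
    ext k
    have := j.isLt
    simp only [Finset.mem_filter, Finset.mem_range]
    omega
  rw [← h]
  simp only [chainProtocol, Matrix.mulVec, dotProduct, Matrix.of_apply, ite_mul, one_mul, zero_mul]
  split_ifs with hj <;> simp [hj]

/-- The measurement angles on input `x`, up to the byproduct signs. -/
def inputAngle (θ : ℕ → ℝ) (pre : ℕ → Bits n) (x : Bits n) (k : ℕ) : ℝ :=
  signedAngle (pre k ⬝ᵥ x) (θ k)

/-- The X byproduct shifts the index, so the amplitude at `0` of the actual state is the ideal
amplitude at the byproduct exponent, which is the output. Inactive qubits have angle zero, where no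
sign correction is needed. -/
lemma chainProtocol_prob (hN : 0 < N) (hact : ∀ k, ¬ act k → θ k = 0) (x : Bits n) (m : Bits N) :
    (chainProtocol N θ act pre).prob x m =
      2 / 2 ^ N * ‖idealState (inputAngle θ pre x) N
        ((chainProtocol N θ act pre).output m)‖ ^ 2 := by
  let φ : ℕ → ℝ := fun k => signedAngle (pre k ⬝ᵥ x + xByproduct (extendBits m) k) (θ k)
  have hang : ∀ k : Fin N,
      signedAngle ((chainProtocol N θ act pre).setting x m k) (θ k) = φ k := by
    intro k
    simp only [Protocol.setting, Pi.add_apply, chainProtocol_adapt_mulVec, φ]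
    by_cases hk : act k
    · rw [if_pos hk]
      rfl
    · rw [hact k hk, signedAngle_angle_zero, signedAngle_angle_zero]
  have hpost : ∀ a, (chainProtocol N θ act pre).postState x m a =
      ∑ b : Bits N, (∏ k : Fin N, xyVec (φ k) (m k) (a k) * conj (xyVec (φ k) (m k) (b k))) *
        clusterState N b := by
    intro a
    refine Finset.sum_congr rfl fun b _ => ?_
    congr 1
    refine Finset.prod_congr rfl fun k _ => ?_
    rw [← eigenproj_xyObs, ← hang k]
    rfl
  simp only [Protocol.prob, hpost]
  rw [sum_norm_sq_product_projection (fun k => xyVec (φ k) (m k))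
    (fun k => sum_norm_xyVec_sq _ _)]
  have hov := norm_overlap_clusterState hN φ (extendBits m)
  simp only [extendBits_val] at hov
  rw [hov]
  obtain ⟨κ, hκ, h⟩ := measuredState_eq θ (fun k => pre k ⬝ᵥ x) (extendBits m) φ N
    (fun _ _ => rfl) N le_rfl
  rw [h 0, mul_zero, sgn_zero, one_mul, zero_add, norm_mul, hκ, one_mul, chainProtocol_output]
  rfl

/-- Exactly half of the strings of outcomes give the output `y`. -/
lemma card_chainProtocol_output (hN : 0 < N) (y : ZMod 2) :
    2 * (Finset.univ.filter fun m : Bits N => (chainProtocol N θ act pre).output m = y).card =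
      2 ^ N := by
  set M := chainProtocol N θ act pre with hM
  -- Flipping the last outcome flips the output, because `N - 1` and `N` differ in parity.
  let e : Bits N := Pi.single ⟨N - 1, by omega⟩ 1
  have hflip : ∀ m, M.output (m + e) = M.output m + 1 := by
    intro m
    have h1 : M.outMask ⬝ᵥ e = 1 := by
      rw [dotProduct_single_one]
      exact if_pos (by simp only []; omega)
    rw [Protocol.output, Protocol.output, dotProduct_add, h1]
    ring
  have heq : (Finset.univ.filter fun m => M.output m = y).card =
      (Finset.univ.filter fun m => ¬ M.output m = y).card := by
    refine Finset.card_equiv (Equiv.addRight e) fun m => ?_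
    simp only [Finset.mem_filter, Finset.mem_univ, true_and, Equiv.coe_addRight, hflip]
    generalize M.output m = o
    revert o y
    decide
  have hsum := Finset.card_filter_add_card_filter_not (s := (Finset.univ : Finset (Bits N)))
    (fun m => M.output m = y)
  rw [← heq, ← two_mul] at hsum
  rw [hsum]
  simp [Finset.card_univ, ZMod.card]

/-- A protocol on the chain whose teleported state is always a computational basis state is
deterministic. -/
lemma chainProtocol_computes (hN : 0 < N) (hact : ∀ k, ¬ act k → θ k = 0) {f : Bits n → ZMod 2}
    (hf : ∀ x, ‖idealState (inputAngle θ pre x) N (f x)‖ = 1) :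
    (chainProtocol N θ act pre).Computes f := by
  intro x
  have hterm : ∀ m : Bits N, (if (chainProtocol N θ act pre).output m = f x then
      (chainProtocol N θ act pre).prob x m else 0) =
      if (chainProtocol N θ act pre).output m = f x then 2 / 2 ^ N else 0 := by
    intro m
    split_ifs with h
    · rw [chainProtocol_prob hN hact, h, hf x, one_pow, mul_one]
    · rfl
  rw [Protocol.outputProb, Finset.sum_congr rfl fun m _ => hterm m, ← Finset.sum_filter,
    Finset.sum_const, nsmul_eq_mul]
  have hcard : (2 : ℝ) * ((Finset.univ.filter fun m : Bits N =>
      (chainProtocol N θ act pre).output m = f x).card : ℝ) = 2 ^ N := by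
    exact_mod_cast card_chainProtocol_output (θ := θ) (act := act) (pre := pre) hN (f x)
  rw [← hcard]
  have hpos : (2 : ℝ) ^ N ≠ 0 := by positivity
  rw [← hcard] at hpos
  have h2 := right_ne_zero_of_mul hpos
  field_simp

/-- Two running parity bits, of the outcomes at even and at odd positions, suffice. -/
lemma chainProtocol_hasRunningBits : (chainProtocol N θ act pre).HasRunningBits 2 := by
  have hdot : ∀ (i : Fin 2) (s : Finset (Fin N)) (m : Bits N),
      (Pi.single i 1 : Bits 2) ⬝ᵥ ∑ k ∈ s, m k • (Pi.single (Fin.ofNat 2 k.val) 1 : Bits 2) =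
      ∑ k ∈ s, if k.val % 2 = i.val then m k else 0 := by
    intro i s m
    rw [single_one_dotProduct, Finset.sum_apply]
    refine Finset.sum_congr rfl fun k _ => ?_
    rw [Pi.smul_apply, Pi.single_apply, smul_eq_mul, mul_ite, mul_one, mul_zero]
    refine if_congr ?_ rfl rfl
    rw [Fin.ext_iff, eq_comm]
    rfl
  refine ⟨fun k => Pi.single (Fin.ofNat 2 k.val) 1,
    fun j => if act j then Pi.single (Fin.ofNat 2 (j.val + 1)) 1 else 0,
    Pi.single (Fin.ofNat 2 (N + 1)) 1, fun m j => ?_, fun m => ?_⟩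
  · by_cases hj : act j
    · simp only [hj, if_true]
      rw [hdot, Finset.sum_filter]
      simp only [chainProtocol, Matrix.mulVec, dotProduct, Matrix.of_apply, hj, true_and]
      refine Finset.sum_congr rfl fun k _ => ?_
      rw [ite_mul, one_mul, zero_mul, ← ite_and]
      refine if_congr (and_congr_right fun _ => ?_) rfl rfl
      simp only [Fin.val_ofNat]
      omega
    · simp only [chainProtocol_adapt_mulVec, hj, if_false, zero_dotProduct]
  · rw [hdot]
    simp only [chainProtocol, dotProduct]
    refine Finset.sum_congr rfl fun k _ => ?_
    rw [ite_mul, one_mul, zero_mul]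
    refine if_congr ?_ rfl rfl
    simp only [Fin.val_ofNat]
    omega

end

end L2MBQC

namespace L2MBQC

noncomputable section

/-! ### Layout of the blocks on the chain -/

/-- If every second qubit is measured at angle zero, the phase gates at the others accumulate. -/
lemma idealState_add_two_mul (φ : ℕ → ℝ) (s r : ℕ) (h : ∀ i < r, φ (s + 2 * i + 1) = 0) :
    idealState φ (s + 2 * r) =
      phaseGate (∑ i ∈ Finset.range r, φ (s + 2 * i)) (idealState φ s) := by
  induction r with
  | zero => simp [phaseGate_zero]
  | succ r ih =>
    have h1 : s + 2 * (r + 1) = s + 2 * r + 1 + 1 := by ring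
    rw [h1, idealState, idealState, h r (by omega), phaseGate_zero, hadGate_hadGate,
      ih fun i hi => h i (by omega), phaseGate_phaseGate, Finset.sum_range_succ, add_comm]

lemma idealState_half_block (φ : ℕ → ℝ) (s n : ℕ) (h : ∀ i < n, φ (s + 2 * i + 1) = 0) :
    idealState φ (s + 2 * n + 1) =
      hadGate (phaseGate (∑ i ∈ Finset.range (n + 1), φ (s + 2 * i)) (idealState φ s)) := by
  rw [idealState, idealState_add_two_mul φ s n h, phaseGate_phaseGate, Finset.sum_range_succ,
    add_comm]

/-- The angles of the qubits in blocks of length `2 n + 2`: in block `t`, the even positions carry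
the signal angle `σ t * δ` (`n` times) and then the constant `c t`, and the last position carries
`β t`. -/
def blockAngle (n : ℕ) (c σ β : ℕ → ℝ) (δ : ℝ) (k : ℕ) : ℝ :=
  if k % (2 * n + 2) % 2 = 0 then
    if k % (2 * n + 2) < 2 * n then σ (k / (2 * n + 2)) * δ else c (k / (2 * n + 2))
  else if k % (2 * n + 2) = 2 * n + 1 then β (k / (2 * n + 2)) else 0

/-- The input bits enter at the first `n` even positions of each block. -/
def blockPre (n k : ℕ) : Bits n := fun i => if k % (2 * n + 2) = 2 * i.val then 1 else 0

/-- The qubits that are not always measured in the `X` basis. -/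
def blockActive (n k : ℕ) : Prop := k % 2 = 0 ∨ k % (2 * n + 2) = 2 * n + 1

instance (n : ℕ) : DecidablePred (blockActive n) := fun _ => instDecidableOr

lemma mod_block_mod_two (n k : ℕ) : k % (2 * n + 2) % 2 = k % 2 :=
  Nat.mod_mod_of_dvd k ⟨n + 1, by ring⟩

lemma blockAngle_of_not_active {n : ℕ} (c σ β : ℕ → ℝ) (δ : ℝ) {k : ℕ} (hk : ¬ blockActive n k) :
    blockAngle n c σ β δ k = 0 := by
  simp only [blockActive, not_or] at hk
  rw [blockAngle, mod_block_mod_two, if_neg hk.1, if_neg hk.2]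

lemma block_mod {n t r : ℕ} (hr : r < 2 * n + 2) : (t * (2 * n + 2) + r) % (2 * n + 2) = r := by
  rw [add_comm, Nat.add_mul_mod_self_right, Nat.mod_eq_of_lt hr]

lemma block_div {n t r : ℕ} (hr : r < 2 * n + 2) : (t * (2 * n + 2) + r) / (2 * n + 2) = t := by
  rw [add_comm, Nat.add_mul_div_right _ _ (by omega), Nat.div_eq_of_lt hr, zero_add]

lemma blockPre_signal {n t : ℕ} (i : Fin n) (x : Bits n) :
    blockPre n (t * (2 * n + 2) + 2 * i.val) ⬝ᵥ x = x i := by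
  have hi := i.isLt
  have h : blockPre n (t * (2 * n + 2) + 2 * i.val) = Pi.single i 1 := by
    funext i'
    rw [blockPre, block_mod (by omega), Pi.single_apply]
    exact if_congr (by rw [Fin.ext_iff]; omega) rfl rfl
  rw [h, single_one_dotProduct]

lemma blockPre_eq_zero {n t r : ℕ} (hr : r < 2 * n + 2) (h : r % 2 = 1 ∨ r = 2 * n) :
    blockPre n (t * (2 * n + 2) + r) = 0 := by
  funext i
  have hi := i.isLt
  rw [blockPre, block_mod hr]
  exact if_neg (by omega)

lemma inputAngle_odd {n : ℕ} (c σ β : ℕ → ℝ) (δ : ℝ) (x : Bits n) (t : ℕ) {i : ℕ} (hi : i < n) :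
    inputAngle (blockAngle n c σ β δ) (blockPre n) x (t * (2 * n + 2) + 2 * i + 1) = 0 := by
  rw [inputAngle, add_assoc, blockAngle, block_mod (by omega), if_neg (by omega),
    if_neg (by omega), signedAngle_angle_zero]

lemma inputAngle_last {n : ℕ} (c σ β : ℕ → ℝ) (δ : ℝ) (x : Bits n) (t : ℕ) :
    inputAngle (blockAngle n c σ β δ) (blockPre n) x (t * (2 * n + 2) + 2 * n + 1) = β t := by
  rw [inputAngle, add_assoc, blockPre_eq_zero (by omega) (by omega), blockAngle,
    block_mod (by omega), block_div (by omega), if_neg (by omega), if_pos rfl, zero_dotProduct,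
    signedAngle_zero]

lemma sum_signedAngle {n : ℕ} (x : Bits n) (δ : ℝ) :
    ∑ i, signedAngle (x i) δ = δ * (n - 2 * hammingNorm x) := by
  have h : ∀ i, signedAngle (x i) δ = δ - 2 * δ * (if x i ≠ 0 then 1 else 0) := by
    intro i
    by_cases hx : x i = 0
    · simp [signedAngle, hx]
    · simp [signedAngle, hx]; ring
  simp only [h, Finset.sum_sub_distrib, ← Finset.mul_sum, Finset.sum_boole, Finset.sum_const,
    Finset.card_univ, Fintype.card_fin, nsmul_eq_mul, hammingNorm]
  ring

lemma sum_inputAngle_even {n : ℕ} (c σ β : ℕ → ℝ) (δ : ℝ) (x : Bits n) (t : ℕ) :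
    ∑ i ∈ Finset.range (n + 1),
      inputAngle (blockAngle n c σ β δ) (blockPre n) x (t * (2 * n + 2) + 2 * i) =
      c t + σ t * (δ * (n - 2 * hammingNorm x)) := by
  rw [Finset.sum_range_succ, Finset.sum_range]
  have h1 : inputAngle (blockAngle n c σ β δ) (blockPre n) x (t * (2 * n + 2) + 2 * n) = c t := by
    rw [inputAngle, blockPre_eq_zero (by omega) (by omega), blockAngle, block_mod (by omega),
      block_div (by omega), if_pos (by omega), if_neg (by omega), zero_dotProduct, signedAngle_zero]
  have h2 : ∀ i : Fin n, inputAngle (blockAngle n c σ β δ) (blockPre n) x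
      (t * (2 * n + 2) + 2 * i.val) = signedAngle (x i) (σ t * δ) := by
    intro i
    have hi := i.isLt
    rw [inputAngle, blockPre_signal, blockAngle, block_mod (by omega), block_div (by omega),
      if_pos (by omega), if_pos (by omega)]
  simp only [h1, h2, sum_signedAngle]
  ring

/-- The teleported state at the beginning of block `t`. -/
lemma idealState_eq_blockState {n : ℕ} (c σ β : ℕ → ℝ) (δ ε : ℝ) (x : Bits n) (t : ℕ) :
    idealState (inputAngle (blockAngle n (fun t => c t + σ t * ε) σ β δ) (blockPre n) x)
        (t * (2 * n + 2)) =
      blockState c σ β (ε + δ * (n - 2 * hammingNorm x)) t := by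
  induction t with
  | zero =>
    rw [zero_mul]
    rfl
  | succ t ih =>
    have h1 : (t + 1) * (2 * n + 2) = t * (2 * n + 2) + 2 * n + 1 + 1 := by ring
    rw [h1, idealState, idealState_half_block _ _ _ fun i hi => inputAngle_odd _ _ _ _ _ _ hi,
      inputAngle_last, sum_inputAngle_even, ih, blockState, xGate]
    congr 4
    ring

/-- The teleported state before the last qubit of block `t`. -/
lemma idealState_end {n : ℕ} (c σ β : ℕ → ℝ) (δ ε : ℝ) (x : Bits n) (t : ℕ) :
    idealState (inputAngle (blockAngle n (fun t => c t + σ t * ε) σ β δ) (blockPre n) x)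
        (t * (2 * n + 2) + 2 * n + 1) =
      hadGate (phaseGate (c t + σ t * (ε + δ * (n - 2 * hammingNorm x)))
        (blockState c σ β (ε + δ * (n - 2 * hammingNorm x)) t)) := by
  rw [idealState_half_block _ _ _ fun i hi => inputAngle_odd _ _ _ _ _ _ hi,
    sum_inputAngle_even, idealState_eq_blockState]
  congr 2
  ring

/-! ### Classical bits and rounds of the block layout -/

variable {n N : ℕ} {θ : ℕ → ℝ}

lemma chainProtocol_numParities (hN : 2 * n < N) :
    (chainProtocol N θ (blockActive n) (blockPre n)).numParities = n := by
  have h : (Finset.univ.image fun k => (chainProtocol N θ (blockActive n) (blockPre n)).pre k).erase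
      0 = Finset.univ.image fun i : Fin n => (Pi.single i 1 : Bits n) := by
    ext v
    simp only [Finset.mem_erase, Finset.mem_image, Finset.mem_univ, true_and]
    constructor
    · rintro ⟨hv, k, rfl⟩
      obtain ⟨i, hi⟩ := Function.ne_iff.1 hv
      have hki : k.val % (2 * n + 2) = 2 * i.val := by
        by_contra h'
        exact hi (if_neg h')
      refine ⟨i, ?_⟩
      funext i'
      rw [Pi.single_apply]
      refine if_congr ?_ rfl rfl
      rw [Fin.ext_iff]
      omega
    · rintro ⟨i, rfl⟩
      have hi := i.isLt
      refine ⟨fun h => ?_, ⟨2 * i.val, by omega⟩, ?_⟩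
      · have := congrFun h i
        simp at this
      · funext i'
        rw [Pi.single_apply]
        refine if_congr ?_ rfl rfl
        change 2 * i.val % (2 * n + 2) = 2 * i'.val ↔ i' = i
        rw [Nat.mod_eq_of_lt (by omega), Fin.ext_iff]
        omega
  rw [Protocol.numParities, h, Finset.card_image_of_injective, Finset.card_univ, Fintype.card_fin]
  intro i i' h
  by_contra hne
  have := congrFun h i
  simp [hne] at this

lemma chainProtocol_usesClassicalBits (hN : 2 * n < N) :
    (chainProtocol N θ (blockActive n) (blockPre n)).UsesClassicalBits (n + 2) :=
  ⟨2, chainProtocol_hasRunningBits, by rw [chainProtocol_numParities hN]⟩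

/-- The round in which qubit `k` is measured. -/
def blockRound (n k : ℕ) : ℕ :=
  if blockActive n k then 2 * (k / (2 * n + 2)) + 1 + k % 2 else 0

/-- The only qubit whose round would be `2 * T` is the last one of the last block, which the chain
omits. -/
lemma blockRound_lt {T k : ℕ} (hk : k + 1 < T * (2 * n + 2)) :
    blockRound n k < 2 * T := by
  have hdiv : k / (2 * n + 2) < T := (Nat.div_lt_iff_lt_mul (by omega)).2 (by omega)
  rw [blockRound]
  split_ifs with h
  · by_cases hk2 : k % 2 = 0
    · omega
    · have hlast : k % (2 * n + 2) = 2 * n + 1 := h.resolve_left hk2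
      have hne : k / (2 * n + 2) + 1 ≠ T := by
        rintro rfl
        have hkd := Nat.div_add_mod k (2 * n + 2)
        rw [hlast] at hkd
        rw [add_mul, one_mul, mul_comm] at hk
        omega
      omega
  · exact Nat.mul_pos two_pos (Nat.zero_lt_of_lt hdiv)

/-- Inactive qubits are measured in round `0`. The even positions of block `t` share round `2 t +
1`, since odd positions alone correct them; its last qubit, corrected by even positions, follows in
round `2 t + 2`. -/
lemma blockRound_lt_blockRound {j k : ℕ} (hj : blockActive n j) (hkj : k < j)
    (hpar : k % 2 ≠ j % 2) : blockRound n k < blockRound n j := by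
  have hle : k / (2 * n + 2) ≤ j / (2 * n + 2) := Nat.div_le_div_right hkj.le
  rw [blockRound, blockRound, if_pos hj]
  split_ifs with hk
  · by_cases hk2 : k % 2 = 0
    · omega
    · have hlast : k % (2 * n + 2) = 2 * n + 1 := hk.resolve_left hk2
      have hne : k / (2 * n + 2) ≠ j / (2 * n + 2) := by
        intro he
        have hkd := Nat.div_add_mod k (2 * n + 2)
        have hjd := Nat.div_add_mod j (2 * n + 2)
        have hjm := Nat.mod_lt j (show 0 < 2 * n + 2 by omega)
        rw [he] at hkd
        omega
      omega
  · omega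

lemma chainProtocol_runsInRounds {T : ℕ} (hN : N < T * (2 * n + 2)) :
    (chainProtocol N θ (blockActive n) (blockPre n)).RunsInRounds (2 * T) := by
  refine ⟨fun k => ⟨blockRound n k, blockRound_lt (by have := k.isLt; omega)⟩, fun j k h => ?_⟩
  have hjk : blockActive n j ∧ k < j ∧ k.val % 2 ≠ j.val % 2 := by
    by_contra h'
    exact h (if_neg h')
  exact blockRound_lt_blockRound hjk.1 hjk.2.1 hjk.2.2

/-- The `p`-th root of unity at which the signal is evaluated on an input of weight `h`. -/
lemma exp_signal {p : ℕ} (hp : 0 < p) (j h : ℕ) (τ : ℝ)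
    (hτ : τ = Real.pi / p * (2 * j - 2 * h)) :
    Complex.exp (-(τ * Complex.I)) ^ p = 1 ∧
      (Complex.exp (-(τ * Complex.I)) = 1 ↔ h ≡ j [MOD p]) := by
  have hpC : (p : ℂ) ≠ 0 := by exact_mod_cast hp.ne'
  have hpi : (2 * Real.pi * Complex.I : ℂ) ≠ 0 := Complex.two_pi_I_ne_zero
  have hexp : -((τ : ℂ) * Complex.I) = (((h : ℤ) - (j : ℤ) : ℤ) : ℂ) / p *
      (2 * Real.pi * Complex.I) := by
    rw [hτ]
    push_cast
    field_simp
    ring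
  constructor
  · rw [← Complex.exp_nat_mul, hexp, Complex.exp_eq_one_iff]
    refine ⟨(h : ℤ) - (j : ℤ), ?_⟩
    field_simp
  · rw [hexp, Complex.exp_eq_one_iff, Nat.ModEq.comm, Nat.modEq_iff_dvd]
    constructor
    · rintro ⟨m, hm⟩
      have h1 := mul_right_cancel₀ hpi hm
      rw [div_eq_iff hpC] at h1
      refine ⟨m, ?_⟩
      rw [mul_comm]
      exact_mod_cast h1
    · rintro ⟨m, hm⟩
      refine ⟨m, ?_⟩
      rw [hm]
      push_cast
      field_simp

end

end L2MBQC

/-! ### Choice of the signal and assembly -/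

theorem mainTheorem1 (p j n : ℕ) (hp : Odd p) (hj : j < p) :
    ∃ M : L2MBQC.Protocol n ((4 * p - 2) * (n + 1) - 1),
      M.state = L2MBQC.clusterState ((4 * p - 2) * (n + 1) - 1) ∧
      M.Computes (L2MBQC.modFn p j n) ∧
      M.UsesClassicalBits (n + 2) ∧
      M.RunsInRounds (4 * p - 2) ∧
      L2MBQC.PreparedInDepth M.state 3 := by
  have hp0 : 0 < p := by omega
  -- The chain has `2 * p - 2` full blocks and one block without its last qubit.
  have hN : (4 * p - 2) * (n + 1) - 1 = (2 * p - 2) * (2 * n + 2) + 2 * n + 1 := by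
    obtain ⟨q, rfl⟩ : ∃ q, p = q + 1 := ⟨p - 1, by omega⟩
    have h1 : 4 * (q + 1) - 2 = 4 * q + 2 := by omega
    have h2 : 2 * (q + 1) - 2 = 2 * q := by omega
    rw [h1, h2]
    have h3 : (4 * q + 2) * (n + 1) = 2 * q * (2 * n + 2) + 2 * n + 1 + 1 := by ring
    omega
  have hT : 4 * p - 2 = 2 * (2 * p - 1) := by omega
  have hNT : (2 * p - 2) * (2 * n + 2) + 2 * n + 1 < (2 * p - 1) * (2 * n + 2) := by
    have h1 : 2 * p - 1 = 2 * p - 2 + 1 := by omega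
    rw [h1, add_mul]
    omega
  rw [hN, hT]
  obtain ⟨c, σ, β, hblocks⟩ := L2MBQC.exists_blocks_mod hp
  set δ : ℝ := Real.pi / p with hδ
  -- This offset, absorbed into the block constants, turns `δ * (n - 2 |x|)` into `(π / p) * (2 j -
  -- 2 |x|)`.
  set ε : ℝ := δ * (2 * j - n) with hε
  refine ⟨L2MBQC.chainProtocol _
    (L2MBQC.blockAngle n (fun t => c t + σ t * ε) σ β δ) (L2MBQC.blockActive n)
    (L2MBQC.blockPre n), rfl, ?_, L2MBQC.chainProtocol_usesClassicalBits (by omega),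
    L2MBQC.chainProtocol_runsInRounds hNT, L2MBQC.clusterState_preparedInDepth _⟩
  refine L2MBQC.chainProtocol_computes (by omega)
    (fun k hk => L2MBQC.blockAngle_of_not_active _ _ _ _ hk) fun x => ?_
  obtain ⟨hroot, hone⟩ := L2MBQC.exp_signal hp0 j (hammingNorm x)
    (ε + δ * (n - 2 * hammingNorm x)) (by rw [hε]; ring)
  obtain ⟨h1, h2⟩ := hblocks _ _ (L2MBQC.idealState_end c σ β δ ε x (2 * p - 2)) hroot
  rw [L2MBQC.modFn]
  split_ifs with hx
  · exact (h1 (hone.2 hx)).1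
  · exact (h2 fun h => hx (hone.1 h)).2
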